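/- Let $n\ge 1$, $\lambda>0$, $\alpha\in(0,1)$, $d>0$ and $R>0$. There exist constants $\delta>0$ and $C>0$, depending only on $n,\lambda,\alpha,d,R$, with the following property. Let $\Omega\subset\mathbb R^n$ be a (nonempty, bounded, open, convex) uniformly convex domain with radius of uniform convexity $R$, that is, for every $x_0\in\partial\Omega$ there is $z\in\mathbb R^n$ with $|x_0-z|=R$ and $\Omega\subset\overline{B_R(z)}$; and let $\operatorname{diam}(\Omega)\le d$. Let $(a^{ij})$ be a measurable function on $\Omega$ whose values are symmetric positive definite $n\times n$ matrices with $\det(a^{ij})\ge\lambda$ almost everywhere in $\Omega$, let $g\in L^n(\Omega)$ and $\varphi\in C^\alpha(\partial\Omega)$, and let $v\in C(\overline\Omega)\cap W^{2,n}_{\mathrm{loc}}(\Omega)$ satisfy $$\sum_{i,j=1}^n a^{ij}v_{ij}=g\ \text{ almost everywhere in }\Omega,\qquad v=\varphi\ \text{ on }\partial\Omega,$$ where $v_{ij}$ are the weak second derivatives of $v$. Then for every $x_0\in\partial\Omega$, $$|v(x)-v(x_0)|\le C\,|x-x_0|^{\frac{\alpha}{\alpha+2}}\left(\|\varphi\|_{C^\alpha(\partial\Omega)}+\|g\|_{L^n(\Omega)}\right)\quad\text{for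 all }x\in\Omega\cap B_\delta(x_0),$$ where $\|\varphi\|_{C^\alpha(\partial\Omega)}=\sup_{\partial\Omega}|\varphi|+\sup_{x\ne y\in\partial\Omega}\frac{|\varphi(x)-\varphi(y)|}{|x-y|^\alpha}$. -/

import Mathlib

open MeasureTheory Set
open scoped ContDiff ENNReal

/-- `Ω` is a uniformly convex domain in `ℝⁿ`, with radius of uniform convexity `R`: it is a
nonempty bounded open convex set, and at every boundary point `x₀` there is a ball of radius `R` that
contains `Ω` and has `x₀` on its boundary sphere. (For a bounded domain with `C²` boundary this
says that all principal curvatures of the boundary are at least `1 / R`.) -/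
structure IsUniformlyConvexDomain {n : ℕ} (R : ℝ) (Ω : Set (EuclideanSpace ℝ (Fin n))) :
    Prop where
  isOpen : IsOpen Ω
  nonempty : Ω.Nonempty
  isBounded : Bornology.IsBounded Ω
  convex : Convex ℝ Ω
  enclosing_ball : ∀ x₀ ∈ frontier Ω, ∃ z : EuclideanSpace ℝ (Fin n),
    dist x₀ z = R ∧ Ω ⊆ Metric.closedBall z R

/-- `w` is the weak `i`-th partial derivative of `u` in `Ω`: both functions are locally integrable
in `Ω`, and `∫ u ∂ᵢη = - ∫ w η` for all `η ∈ C_c^∞(Ω)`. -/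
structure HasWeakPartialDeriv {n : ℕ} (Ω : Set (EuclideanSpace ℝ (Fin n))) (i : Fin n)
    (u w : EuclideanSpace ℝ (Fin n) → ℝ) : Prop where
  locallyIntegrableOn : LocallyIntegrableOn u Ω volume
  locallyIntegrableOn_deriv : LocallyIntegrableOn w Ω volume
  integral_eq : ∀ η : EuclideanSpace ℝ (Fin n) → ℝ,
    ContDiff ℝ ∞ η → HasCompactSupport η → tsupport η ⊆ Ω →
      ∫ x in Ω, u x * fderiv ℝ η x (EuclideanSpace.single i 1) = - ∫ x in Ω, w x * η x

/-- `f ∈ L^p_loc(Ω)`. -/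
def MemLpLoc {n : ℕ} (p : ℝ≥0∞) (Ω : Set (EuclideanSpace ℝ (Fin n)))
    (f : EuclideanSpace ℝ (Fin n) → ℝ) : Prop :=
  ∀ K : Set (EuclideanSpace ℝ (Fin n)), IsCompact K → K ⊆ Ω → MemLp f p (volume.restrict K)

/-- `v ∈ W^{2,p}_loc(Ω)`, with weak first derivatives `Dv i = v_i` and weak second derivatives
`D2v i j = v_{ij}`. (These are determined by `v` almost everywhere in `Ω`.) -/
structure MemSobolevTwoLoc {n : ℕ} (p : ℝ≥0∞) (Ω : Set (EuclideanSpace ℝ (Fin n)))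
    (v : EuclideanSpace ℝ (Fin n) → ℝ) (Dv : Fin n → EuclideanSpace ℝ (Fin n) → ℝ)
    (D2v : Fin n → Fin n → EuclideanSpace ℝ (Fin n) → ℝ) : Prop where
  memLpLoc : MemLpLoc p Ω v
  memLpLoc_deriv : ∀ i, MemLpLoc p Ω (Dv i)
  memLpLoc_deriv2 : ∀ i j, MemLpLoc p Ω (D2v i j)
  weak_deriv : ∀ i, HasWeakPartialDeriv Ω i v (Dv i)
  weak_deriv2 : ∀ i j, HasWeakPartialDeriv Ω j (Dv i) (D2v i j)

/-- The absolute values of `φ` on `S`; their supremum is the sup norm. -/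
def absValues {n : ℕ} (S : Set (EuclideanSpace ℝ (Fin n)))
    (φ : EuclideanSpace ℝ (Fin n) → ℝ) : Set ℝ :=
  {r | ∃ x ∈ S, r = |φ x|}

/-- The Hölder quotients of `φ` on `S` with exponent `α`. -/
def holderQuotients {n : ℕ} (α : ℝ) (S : Set (EuclideanSpace ℝ (Fin n)))
    (φ : EuclideanSpace ℝ (Fin n) → ℝ) : Set ℝ :=
  {r | ∃ x ∈ S, ∃ y ∈ S, x ≠ y ∧ r = |φ x - φ y| / ‖x - y‖ ^ α}

/-- `φ ∈ C^α(S)`: both suprema in the Hölder norm are finite. -/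
def MemHolderOn {n : ℕ} (α : ℝ) (S : Set (EuclideanSpace ℝ (Fin n)))
    (φ : EuclideanSpace ℝ (Fin n) → ℝ) : Prop :=
  BddAbove (absValues S φ) ∧ BddAbove (holderQuotients α S φ)

/-- The norm `‖φ‖_{C^α(S)} = sup_S |φ| + sup_{x ≠ y ∈ S} |φ x - φ y| / |x - y|^α`. -/
noncomputable def holderNormOn {n : ℕ} (α : ℝ) (S : Set (EuclideanSpace ℝ (Fin n)))
    (φ : EuclideanSpace ℝ (Fin n) → ℝ) : ℝ :=
  sSup (absValues S φ) + sSup (holderQuotients α S φ)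

/-- The norm `‖g‖_{L^p(Ω)}` with respect to Lebesgue measure. -/
noncomputable def lpNormOn {n : ℕ} (p : ℝ≥0∞) (Ω : Set (EuclideanSpace ℝ (Fin n)))
    (g : EuclideanSpace ℝ (Fin n) → ℝ) : ℝ :=
  (eLpNorm g p (volume.restrict Ω)).toReal

/-!
The boundary Hölder estimate follows from the Alexandrov–Bakelman–Pucci (ABP) maximum principle and
a linear barrier.

**The maximum principle.** For `u` of class `C²` on a bounded open set `U`, suppose that
`u - ⟪p, ·⟫` is larger at some point of `U` than on `∂U`, by more than `r` times the diameter. Then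
every slope in the ball `B_r(p)` is attained as the gradient of `u` at a point where the Hessian is
negative semidefinite, so the area formula gives `|B_r| ≤ ∫_U F(D²u)`, where `F(M) = det (-M)` if
`M` is symmetric negative semidefinite and `F(M) = 0` otherwise
(`volume_ball_le_lintegral_concaveDet_hessianMatrix`).
Since `F` is upper semicontinuous and `F(M) ≤ C |M|ⁿ`, the right-hand side is upper semicontinuous
under `L^n` convergence of Hessians (`le_lintegral_concaveDet_of_tendsto`), and mollification carries
the estimate to `W^{2,n}_loc` (`MemSobolevTwoLoc.volume_ball_le`). Working with `F(D²u)` on all of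
`U`, and not with `det D²u` on the contact set, removes any need to know how contact sets behave in
the limit. For a solution of `∑ aᵢⱼ vᵢⱼ = g` with `det a ≥ λ`, the arithmetic–geometric mean
inequality bounds `F(D²v)` by `|g|ⁿ / (λ nⁿ)` pointwise (`concaveDet_le_of_sum_eq`), without any upper
bound on `a`; this gives `MemSobolevTwoLoc.sub_inner_le`.

**The barrier.** If `Ω ⊆ B_R(z)` with `|x₀ - z| = R`, then `w(x) = ⟪z - x₀, x - x₀⟫` satisfies
`w ≥ |x - x₀|² / 2` on `Ω`, and `w`, being linear, does not enter the equation. The ABP estimate on `Ω`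
bounds `|v|`; the ABP estimate on `Ω ∩ B_r(x₀)` applied to `v - φ(x₀) - K w` with `K ~ r⁻²` gives
`v(x) - φ(x₀) ≲ r^α + r⁻² |x - x₀| + r`, and `r = |x - x₀|^{1/(α+2)}` is the optimal choice
(`MemSobolevTwoLoc.sub_le_rpow`). The lower bound is the upper bound for `-v`.
-/

open scoped Topology RealInnerProductSpace Convolution
open Filter Metric

/-! ### Determinants on the cone of negative semidefinite matrices -/

theorem Matrix.isClosed_setOf_posSemidef {n : ℕ} :
    IsClosed {M : Matrix (Fin n) (Fin n) ℝ | M.PosSemidef} := by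
  simp only [Matrix.posSemidef_iff_dotProduct_mulVec, Matrix.IsHermitian, Set.ofPred_and,
    Set.ofPred_forall]
  refine (isClosed_eq (by fun_prop) continuous_id).inter (isClosed_iInter fun x => ?_)
  exact isClosed_le continuous_const (by fun_prop)

open Classical in
/-- The determinant of `-M` where `M` is symmetric negative semidefinite, and `0` for all other `M`.
Evaluated at the Hessian of `u`, it is the Jacobian of the gradient map of `u` on the set where the
graph of `u` can be touched from above by a plane. -/
noncomputable def concaveDet {n : ℕ} (M : Matrix (Fin n) (Fin n) ℝ) : ℝ≥0∞ :=
  if (-M).PosSemidef then ENNReal.ofReal (-M).det else 0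

theorem measurable_concaveDet {X : Type*} [MeasurableSpace X] {n : ℕ}
    {M : X → Matrix (Fin n) (Fin n) ℝ} (hM : ∀ i j, Measurable fun x => M x i j) :
    Measurable fun x => concaveDet (M x) := by
  classical
  have hof : Continuous fun f : Fin n → Fin n → ℝ => -Matrix.of f := by fun_prop
  have h : Measurable fun f : Fin n → Fin n → ℝ => concaveDet (Matrix.of f) := by
    refine Measurable.ite ?_ ?_ measurable_const
    · exact (Matrix.isClosed_setOf_posSemidef.preimage hof).measurableSet
    · exact (ENNReal.continuous_ofReal.comp hof.matrix_det).measurable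
  exact h.comp (measurable_pi_lambda _ fun i => measurable_pi_lambda _ fun j => hM i j)

theorem concaveDet_le_ofReal_det {n : ℕ} (M : Matrix (Fin n) (Fin n) ℝ) :
    concaveDet M ≤ ENNReal.ofReal (-M).det := by
  unfold concaveDet; split_ifs <;> simp

/-- Upper semicontinuity: the cone of negative semidefinite matrices is closed. -/
theorem limsup_concaveDet_le {n : ℕ} {M : ℕ → Matrix (Fin n) (Fin n) ℝ}
    {M₀ : Matrix (Fin n) (Fin n) ℝ} (hM : Tendsto M atTop (𝓝 M₀)) :
    limsup (fun k => concaveDet (M k)) atTop ≤ concaveDet M₀ := by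
  by_cases h : (-M₀).PosSemidef
  · have h1 : Tendsto (fun k => ENNReal.ofReal (-(M k)).det) atTop
        (𝓝 (ENNReal.ofReal (-M₀).det)) :=
      ((ENNReal.continuous_ofReal.comp (continuous_neg.matrix_det)).tendsto M₀).comp hM
    calc limsup (fun k => concaveDet (M k)) atTop
        ≤ limsup (fun k => ENNReal.ofReal (-(M k)).det) atTop :=
          limsup_le_limsup (Eventually.of_forall fun k => concaveDet_le_ofReal_det _)
      _ = ENNReal.ofReal (-M₀).det := h1.limsup_eq
      _ = concaveDet M₀ := by rw [concaveDet, if_pos h]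
  · have h1 : ∀ᶠ k in atTop, ¬ (-(M k)).PosSemidef :=
      hM.eventually
        ((Matrix.isClosed_setOf_posSemidef.preimage continuous_neg).isOpen_compl.mem_nhds h)
    have h2 : (fun k => concaveDet (M k)) =ᶠ[atTop] fun _ => (0 : ℝ≥0∞) := by
      filter_upwards [h1] with k hk
      rw [concaveDet, if_neg hk]
    rw [limsup_congr h2]
    simp

theorem concaveDet_le_sum_pow {n : ℕ} (hn : 1 ≤ n) (M : Matrix (Fin n) (Fin n) ℝ) :
    concaveDet M ≤ (n.factorial : ℝ≥0∞) * ∑ i, ∑ j, ‖M i j‖ₑ ^ n := by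
  have : Nonempty (Fin n) := ⟨⟨0, hn⟩⟩
  obtain ⟨p, -, hp⟩ := Finset.exists_max_image Finset.univ
    (fun p : Fin n × Fin n => |M p.1 p.2|) Finset.univ_nonempty
  have h1 : |(-M).det| ≤ n.factorial * |M p.1 p.2| ^ n := by
    have := Matrix.det_le (A := -M) (abv := AbsoluteValue.abs) (x := |M p.1 p.2|) ?_
    · simpa using this
    · intro i j
      simpa using hp (i, j) (Finset.mem_univ _)
  calc concaveDet M ≤ ENNReal.ofReal (-M).det := concaveDet_le_ofReal_det M
    _ ≤ ENNReal.ofReal (n.factorial * |M p.1 p.2| ^ n) :=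
        ENNReal.ofReal_le_ofReal ((le_abs_self _).trans h1)
    _ = n.factorial * ‖M p.1 p.2‖ₑ ^ n := by
        rw [ENNReal.ofReal_mul (by positivity), ENNReal.ofReal_pow (by positivity),
          ENNReal.ofReal_natCast, Real.enorm_eq_ofReal_abs]
    _ ≤ _ := by
        gcongr
        refine (Finset.single_le_sum (f := fun j => ‖M p.1 j‖ₑ ^ n) (fun _ _ => zero_le)
          (Finset.mem_univ p.2)).trans ?_
        exact Finset.single_le_sum (f := fun i => ∑ j, ‖M i j‖ₑ ^ n) (fun _ _ => zero_le)
          (Finset.mem_univ p.1)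

theorem Matrix.PosSemidef.det_le_trace_div_pow {n : ℕ} (hn : 1 ≤ n) {A : Matrix (Fin n) (Fin n) ℝ}
    (hA : A.PosSemidef) : A.det ≤ (A.trace / n) ^ n := by
  have hn' : (0 : ℝ) < n := by exact_mod_cast hn
  rw [hA.isHermitian.det_eq_prod_eigenvalues, hA.isHermitian.trace_eq_sum_eigenvalues]
  simp only [RCLike.ofReal_real_eq_id, id]
  set z := hA.isHermitian.eigenvalues
  have hz : ∀ i, 0 ≤ z i := hA.eigenvalues_nonneg
  have h := Real.geom_mean_le_arith_mean_weighted Finset.univ (fun _ : Fin n => (n : ℝ)⁻¹) z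
    (fun _ _ => by positivity) (by simp [hn'.ne']) (fun i _ => hz i)
  calc ∏ i, z i = (∏ i, z i ^ ((n : ℝ)⁻¹)) ^ n := by
        rw [← Finset.prod_pow]
        refine Finset.prod_congr rfl fun i _ => ?_
        rw [Real.rpow_inv_natCast_pow (hz i) (by omega)]
    _ ≤ (∑ i, (n : ℝ)⁻¹ * z i) ^ n :=
        pow_le_pow_left₀ (Finset.prod_nonneg fun i _ => Real.rpow_nonneg (hz i) _) h n
    _ = _ := by rw [← Finset.mul_sum, div_eq_inv_mul]

/-- Arithmetic–geometric mean inequality for the product of a positive definite and a positive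
semidefinite matrix. -/
theorem Matrix.det_mul_det_le_trace_mul_div_pow {n : ℕ} (hn : 1 ≤ n)
    {A N : Matrix (Fin n) (Fin n) ℝ} (hA : A.PosDef) (hN : N.PosSemidef) :
    A.det * N.det ≤ ((A * N).trace / n) ^ n := by
  open scoped MatrixOrder in
  obtain ⟨B, rfl⟩ := CStarAlgebra.nonneg_iff_eq_star_mul_self.mp hA.posSemidef.nonneg
  have h := (hN.mul_mul_conjTranspose_same B).det_le_trace_div_pow hn
  rw [Matrix.star_eq_conjTranspose, Matrix.mul_assoc, Matrix.trace_mul_comm, Matrix.det_mul]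
  rw [Matrix.det_mul, Matrix.det_mul] at h
  linarith

/-- Pointwise consequence of the equation `∑ aᵢⱼ Mᵢⱼ = g` with `det a ≥ λ`. -/
theorem concaveDet_le_of_sum_eq {n : ℕ} (hn : 1 ≤ n) {lam : ℝ} (hlam : 0 < lam)
    {A M : Matrix (Fin n) (Fin n) ℝ} (hA : A.PosDef) (hdet : lam ≤ A.det) {g : ℝ}
    (hg : ∑ i, ∑ j, A i j * M i j = g) :
    concaveDet M ≤ ENNReal.ofReal (1 / (lam * n ^ n)) * ‖g‖ₑ ^ n := by
  have hn' : (0 : ℝ) < n := by exact_mod_cast hn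
  unfold concaveDet
  split_ifs with h
  swap
  · exact zero_le
  have h1 := Matrix.det_mul_det_le_trace_mul_div_pow hn hA h
  have h2 : (A * -M).trace = -g := by
    have hs : ∀ i j, M j i = M i j := fun i j => by
      have := h.isHermitian.apply i j
      simpa using this
    simp [← hg, Matrix.trace, Matrix.mul_apply, hs]
  rw [h2] at h1
  have h3 : lam * (-M).det ≤ |g| ^ n / n ^ n := by
    calc lam * (-M).det ≤ A.det * (-M).det := by gcongr; exact h.det_nonneg
      _ ≤ (-g / n) ^ n := h1
      _ ≤ |(-g / n) ^ n| := le_abs_self _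
      _ = _ := by rw [abs_pow, abs_div, abs_neg, Nat.abs_cast, div_pow]
  rw [Real.enorm_eq_ofReal_abs, ← ENNReal.ofReal_pow (abs_nonneg _),
    ← ENNReal.ofReal_mul (by positivity)]
  refine ENNReal.ofReal_le_ofReal ?_
  rw [← mul_le_mul_iff_of_pos_left hlam]
  calc _ ≤ _ := h3
    _ = _ := by field_simp

/-! ### Passage to the limit in integrals of `concaveDet` -/

theorem ENNReal.add_pow_le_two_pow_mul (a b : ℝ≥0∞) (n : ℕ) :
    (a + b) ^ n ≤ 2 ^ n * (a ^ n + b ^ n) := by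
  rcases le_total a b with h | h
  · calc (a + b) ^ n ≤ (2 * b) ^ n := by gcongr; rw [two_mul]; gcongr
      _ = 2 ^ n * b ^ n := mul_pow _ _ _
      _ ≤ _ := by gcongr; exact le_add_self
  · calc (a + b) ^ n ≤ (2 * a) ^ n := by gcongr; rw [two_mul]; gcongr
      _ = 2 ^ n * a ^ n := mul_pow _ _ _
      _ ≤ _ := by gcongr; exact le_self_add

theorem lintegral_enorm_pow_eq_eLpNorm_pow {X : Type*} [MeasurableSpace X] {μ : Measure X} {n : ℕ}
    (hn : 1 ≤ n) (f : X → ℝ) : ∫⁻ x, ‖f x‖ₑ ^ n ∂μ = eLpNorm f n μ ^ n := by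
  have := eLpNorm_nnreal_pow_eq_lintegral (f := f) (μ := μ) (p := (n : NNReal))
    (by exact_mod_cast (by omega : n ≠ 0))
  simpa using this.symm

theorem lintegral_sum_enorm_pow {X ι : Type*} [MeasurableSpace X] [Fintype ι] {μ : Measure X}
    {n : ℕ} (hn : 1 ≤ n) {f : ι → ι → X → ℝ} (hf : ∀ i j, Measurable (f i j)) :
    ∫⁻ x, ∑ i, ∑ j, ‖f i j x‖ₑ ^ n ∂μ = ∑ i, ∑ j, eLpNorm (f i j) n μ ^ n := by
  have h : ∀ i j, Measurable fun x => ‖f i j x‖ₑ ^ n := fun i j => (hf i j).enorm.pow_const n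
  rw [lintegral_finsetSum _ fun i _ => Finset.measurable_sum _ fun j _ => h i j]
  refine Finset.sum_congr rfl fun i _ => ?_
  rw [lintegral_finsetSum _ fun j _ => h i j]
  exact Finset.sum_congr rfl fun j _ => lintegral_enorm_pow_eq_eLpNorm_pow hn _

/-- `∫ concaveDet` is upper semicontinuous along sequences that converge almost everywhere and in
`L^n`. -/
theorem le_lintegral_concaveDet_of_tendsto {X : Type*} [MeasurableSpace X] {μ : Measure X} {n : ℕ}
    (hn : 1 ≤ n) {M : ℕ → X → Matrix (Fin n) (Fin n) ℝ} {M₀ : X → Matrix (Fin n) (Fin n) ℝ}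
    (hM : ∀ k i j, Measurable fun x => M k x i j)
    (hM₀ : ∀ i j, MemLp (fun x => M₀ x i j) n μ)
    (hae : ∀ i j, ∀ᵐ x ∂μ, Tendsto (fun k => M k x i j) atTop (𝓝 (M₀ x i j)))
    (hLp : ∀ i j, Tendsto (fun k => eLpNorm (fun x => M k x i j - M₀ x i j) n μ) atTop (𝓝 0))
    {c : ℝ≥0∞} (hc : ∀ᶠ k in atTop, c ≤ ∫⁻ x, concaveDet (M k x) ∂μ) :
    c ≤ ∫⁻ x, concaveDet (M₀ x) ∂μ := by
  -- A measurable representative of the limit.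
  wlog hmeas : ∀ i j, Measurable fun x => M₀ x i j generalizing M₀
  · let M₁ : X → Matrix (Fin n) (Fin n) ℝ := fun x =>
      Matrix.of fun i j => (hM₀ i j).aestronglyMeasurable.mk _ x
    have h1 : ∀ i j, (fun x => M₀ x i j) =ᵐ[μ] fun x => M₁ x i j := fun i j =>
      (hM₀ i j).aestronglyMeasurable.ae_eq_mk
    have h2 := this (M₀ := M₁) (fun i j => (hM₀ i j).ae_eq (h1 i j))
      (fun i j => by
        filter_upwards [hae i j, h1 i j] with x hx hx'
        rwa [← hx'])
      (fun i j => by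
        refine (hLp i j).congr fun k => eLpNorm_congr_ae ?_
        filter_upwards [h1 i j] with x hx
        rw [hx])
      (fun i j => (hM₀ i j).aestronglyMeasurable.stronglyMeasurable_mk.measurable)
    refine h2.trans_eq (lintegral_congr_ae ?_)
    have h3 : ∀ᵐ x ∂μ, ∀ i j, M₀ x i j = M₁ x i j := by
      rw [ae_all_iff]; intro i
      rw [ae_all_iff]; intro j
      exact h1 i j
    filter_upwards [h3] with x hx
    congr 1
    ext i j
    exact (hx i j).symm
  set C : ℝ≥0∞ := n.factorial * 2 ^ n with hC
  have hCtop : C ≠ ⊤ := by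
    rw [hC]
    exact ENNReal.mul_ne_top (ENNReal.natCast_ne_top _) (ENNReal.pow_ne_top (by simp))
  set S : X → ℝ≥0∞ := fun x => ∑ i, ∑ j, ‖M₀ x i j‖ₑ ^ n
  set D : ℕ → X → ℝ≥0∞ := fun k x => ∑ i, ∑ j, ‖M k x i j - M₀ x i j‖ₑ ^ n
  have hDmeas : ∀ k, Measurable (D k) := fun k => by
    refine Finset.measurable_sum _ fun i _ => Finset.measurable_sum _ fun j _ => ?_
    exact (((hM k i j).sub (hmeas i j)).enorm).pow_const n
  have hFmeas : ∀ k, Measurable fun x => concaveDet (M k x) := fun k =>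
    measurable_concaveDet (hM k)
  have hbound : ∀ k x, concaveDet (M k x) ≤ C * S x + C * D k x := by
    intro k x
    refine (concaveDet_le_sum_pow hn _).trans ?_
    rw [← mul_add, hC, mul_assoc]
    gcongr
    simp only [S, D]
    rw [← Finset.sum_add_distrib, Finset.mul_sum]
    refine Finset.sum_le_sum fun i _ => ?_
    rw [← Finset.sum_add_distrib, Finset.mul_sum]
    refine Finset.sum_le_sum fun j _ => ?_
    refine le_trans ?_ (ENNReal.add_pow_le_two_pow_mul _ _ n)
    gcongr
    calc ‖M k x i j‖ₑ = ‖M₀ x i j + (M k x i j - M₀ x i j)‖ₑ := by rw [add_sub_cancel]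
      _ ≤ _ := enorm_add_le _ _
  have hDint : ∀ k, ∫⁻ x, D k x ∂μ
      = ∑ i, ∑ j, eLpNorm (fun x => M k x i j - M₀ x i j) n μ ^ n := by
    exact fun k => lintegral_sum_enorm_pow hn (f := fun i j x => M k x i j - M₀ x i j)
      fun i j => (hM k i j).sub (hmeas i j)
  have hDlim : Tendsto (fun k => C * ∫⁻ x, D k x ∂μ) atTop (𝓝 0) := by
    have h1 : Tendsto (fun k => ∫⁻ x, D k x ∂μ) atTop (𝓝 (∑ i : Fin n, ∑ j : Fin n, 0 ^ n)) := by
      simp only [hDint]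
      refine tendsto_finsetSum _ fun i _ => tendsto_finsetSum _ fun j _ => ?_
      exact ((ENNReal.continuous_pow n).tendsto 0).comp (hLp i j)
    have h2 := ENNReal.Tendsto.const_mul (a := C) h1 (Or.inr hCtop)
    simpa [zero_pow (by omega : n ≠ 0)] using h2
  have hSfin : ∫⁻ x, C * S x ∂μ ≠ ⊤ := by
    rw [lintegral_const_mul _ (Finset.measurable_sum _ fun i _ => Finset.measurable_sum _ fun j _ =>
      ((hmeas i j).enorm).pow_const n)]
    refine ENNReal.mul_ne_top hCtop ?_
    rw [lintegral_sum_enorm_pow hn (f := fun i j x => M₀ x i j) hmeas]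
    exact ENNReal.sum_ne_top.2 fun i _ => ENNReal.sum_ne_top.2 fun j _ =>
      ENNReal.pow_ne_top (hM₀ i j).eLpNorm_ne_top
  -- Reverse Fatou for the truncated differences, which `C * S` dominates.
  have hG := limsup_lintegral_le (μ := μ) (f := fun k x => concaveDet (M k x) - C * D k x)
    (fun x => C * S x) (fun k => (hFmeas k).sub ((hDmeas k).const_mul C))
    (fun k => Eventually.of_forall fun x => tsub_le_iff_right.2 (hbound k x)) hSfin
  have hG2 : ∫⁻ x, limsup (fun k => concaveDet (M k x) - C * D k x) atTop ∂μ
      ≤ ∫⁻ x, concaveDet (M₀ x) ∂μ := by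
    refine lintegral_mono_ae ?_
    have h3 : ∀ᵐ x ∂μ, ∀ i j, Tendsto (fun k => M k x i j) atTop (𝓝 (M₀ x i j)) := by
      rw [ae_all_iff]; intro i
      rw [ae_all_iff]; intro j
      exact hae i j
    filter_upwards [h3] with x hx
    refine (limsup_le_limsup (Eventually.of_forall fun k => tsub_le_self)).trans
      (limsup_concaveDet_le (M := fun k => M k x) ?_)
    exact tendsto_pi_nhds.2 fun i => tendsto_pi_nhds.2 fun j => hx i j
  refine ENNReal.le_of_forall_pos_le_add fun ε hε _ => ?_
  have hε' : ∀ᶠ k in atTop, C * ∫⁻ x, D k x ∂μ < ε :=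
    hDlim.eventually (gt_mem_nhds (by exact_mod_cast hε))
  have h4 : c - ε ≤ limsup (fun k => ∫⁻ x, (concaveDet (M k x) - C * D k x) ∂μ) atTop := by
    refine le_limsup_of_frequently_le (Eventually.frequently ?_)
    filter_upwards [hc, hε'] with k hk hk'
    refine tsub_le_iff_right.2 (hk.trans ?_)
    calc ∫⁻ x, concaveDet (M k x) ∂μ
        ≤ ∫⁻ x, ((concaveDet (M k x) - C * D k x) + C * D k x) ∂μ :=
          lintegral_mono fun x => le_tsub_add
      _ = ∫⁻ x, (concaveDet (M k x) - C * D k x) ∂μ + C * ∫⁻ x, D k x ∂μ := by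
          rw [lintegral_add_right _ ((hDmeas k).const_mul C), lintegral_const_mul _ (hDmeas k)]
      _ ≤ _ := by gcongr
  exact tsub_le_iff_right.1 (h4.trans (hG.trans hG2))

/-! ### The Alexandrov estimate for functions of class `C²` -/

/-- The matrix of second partial derivatives: the `(i, j)` entry is `∂ⱼ ∂ᵢ u`. -/
noncomputable def hessianMatrix {n : ℕ} (u : EuclideanSpace ℝ (Fin n) → ℝ)
    (x : EuclideanSpace ℝ (Fin n)) : Matrix (Fin n) (Fin n) ℝ :=
  Matrix.of fun i j =>
    fderiv ℝ (fun y => fderiv ℝ u y (EuclideanSpace.single i 1)) x (EuclideanSpace.single j 1)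

theorem ContDiff.differentiable_fderiv_of_two {F : Type*} [NormedAddCommGroup F] [NormedSpace ℝ F]
    {u : F → ℝ} (hu : ContDiff ℝ 2 u) : Differentiable ℝ (fderiv ℝ u) :=
  (hu.fderiv_right (m := 1) (by norm_num)).differentiable one_ne_zero

theorem hessianMatrix_apply {n : ℕ} {u : EuclideanSpace ℝ (Fin n) → ℝ} (hu : ContDiff ℝ 2 u)
    (x : EuclideanSpace ℝ (Fin n)) (i j : Fin n) :
    hessianMatrix u x i j =
      fderiv ℝ (fderiv ℝ u) x (EuclideanSpace.single j 1) (EuclideanSpace.single i 1) := by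
  simp only [hessianMatrix, Matrix.of_apply]
  rw [fderiv_clm_apply hu.differentiable_fderiv_of_two.differentiableAt (by fun_prop)]
  simp

theorem continuous_hessianMatrix_apply {n : ℕ} {u : EuclideanSpace ℝ (Fin n) → ℝ}
    (hu : ContDiff ℝ 2 u) (i j : Fin n) : Continuous fun x => hessianMatrix u x i j := by
  simp only [hessianMatrix_apply hu]
  have h : Continuous (fderiv ℝ (fderiv ℝ u)) :=
    (hu.fderiv_right (m := 1) (by norm_num)).continuous_fderiv one_ne_zero
  exact (h.clm_apply continuous_const).clm_apply continuous_const

theorem IsLocalMax.deriv_deriv_nonpos {f : ℝ → ℝ} {t : ℝ} (h : IsLocalMax f t)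
    (hf : ContinuousAt f t) : deriv (deriv f) t ≤ 0 := by
  by_contra! hpos
  have hmin := isLocalMin_of_deriv_deriv_pos hpos h.deriv_eq_zero hf
  have hconst : f =ᶠ[𝓝 t] fun _ => f t := by
    filter_upwards [h, hmin] with s h1 h2 using le_antisymm h1 h2
  have h2 : deriv (deriv f) t = 0 := by
    rw [hconst.deriv.deriv_eq]
    simp
  exact hpos.ne' h2

theorem IsLocalMax.fderiv_fderiv_apply_self_nonpos {F : Type*} [NormedAddCommGroup F]
    [NormedSpace ℝ F] {u : F → ℝ} (hu : ContDiff ℝ 2 u) {x : F} (h : IsLocalMax u x) (e : F) :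
    fderiv ℝ (fderiv ℝ u) x e e ≤ 0 := by
  have hline : ∀ t : ℝ, HasDerivAt (fun t : ℝ => x + t • e) e t := fun t => by
    simpa using ((hasDerivAt_id t).smul_const e).const_add x
  have h1 : ∀ t, HasDerivAt (fun t : ℝ => u (x + t • e)) (fderiv ℝ u (x + t • e) e) t := fun t =>
    ((hu.differentiable two_ne_zero).differentiableAt.hasFDerivAt).comp_hasDerivAt t (hline t)
  have h2 : HasDerivAt (fun t : ℝ => fderiv ℝ u (x + t • e) e)
      (fderiv ℝ (fderiv ℝ u) x e e) 0 := by
    have h3 : HasFDerivAt (fderiv ℝ u) (fderiv ℝ (fderiv ℝ u) x) (x + (0 : ℝ) • e) := by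
      simpa using (hu.differentiable_fderiv_of_two x).hasFDerivAt
    exact ((ContinuousLinearMap.apply ℝ ℝ e).hasFDerivAt.comp_hasDerivAt 0
      (h3.comp_hasDerivAt 0 (hline 0)))
  have h4 : IsLocalMax (fun t : ℝ => u (x + t • e)) 0 := by
    have hc : ContinuousAt (fun t : ℝ => x + t • e) 0 := (hline 0).continuousAt
    have h5 : IsLocalMax u (x + (0 : ℝ) • e) := by simpa using h
    exact IsMaxFilter.comp_tendsto (g := fun t : ℝ => x + t • e) h5 hc
  have h6 := h4.deriv_deriv_nonpos (h1 0).continuousAt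
  rwa [funext fun t => (h1 t).deriv, h2.deriv] at h6

theorem posSemidef_neg_hessianMatrix {n : ℕ} {u : EuclideanSpace ℝ (Fin n) → ℝ}
    (hu : ContDiff ℝ 2 u) {x : EuclideanSpace ℝ (Fin n)}
    (h : ∀ e, fderiv ℝ (fderiv ℝ u) x e e ≤ 0) : (-hessianMatrix u x).PosSemidef := by
  have hsymm : IsSymmSndFDerivAt ℝ u x := hu.contDiffAt.isSymmSndFDerivAt (by simp)
  refine Matrix.PosSemidef.of_dotProduct_mulVec_nonneg ?_ fun ξ => ?_
  · refine Matrix.IsHermitian.ext fun i j => ?_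
    simp only [Matrix.neg_apply, hessianMatrix_apply hu, star_trivial]
    rw [hsymm]
  · have h1 := h (∑ i, ξ i • EuclideanSpace.single i (1 : ℝ))
    simp only [map_sum, map_smul, _root_.sum_apply, _root_.smul_apply,
      smul_eq_mul] at h1
    have h2 : star ξ ⬝ᵥ (-hessianMatrix u x).mulVec ξ
        = -∑ i, ξ i * ∑ j, ξ j * fderiv ℝ (fderiv ℝ u) x (EuclideanSpace.single j 1)
            (EuclideanSpace.single i 1) := by
      simp only [dotProduct, Matrix.mulVec, Matrix.neg_apply, hessianMatrix_apply hu, star_trivial,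
        ← Finset.sum_neg_distrib, Finset.mul_sum]
      refine Finset.sum_congr rfl fun i _ => Finset.sum_congr rfl fun j _ => ?_
      ring
    rw [h2]
    linarith

/-- The derivative of the gradient map. -/
theorem hasFDerivAt_gradient {n : ℕ} {u : EuclideanSpace ℝ (Fin n) → ℝ} (hu : ContDiff ℝ 2 u)
    (x : EuclideanSpace ℝ (Fin n)) :
    ∃ A : EuclideanSpace ℝ (Fin n) →L[ℝ] EuclideanSpace ℝ (Fin n),
      HasFDerivAt (gradient u) A x ∧ A.det = (hessianMatrix u x).det := by
  let T : (EuclideanSpace ℝ (Fin n) →L[ℝ] ℝ) →L[ℝ] EuclideanSpace ℝ (Fin n) :=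
    LinearMap.toContinuousLinearMap
      { toFun := (InnerProductSpace.toDual ℝ (EuclideanSpace ℝ (Fin n))).symm
        map_add' := fun a b => by simp
        map_smul' := fun a b => by simp }
  refine ⟨T ∘L fderiv ℝ (fderiv ℝ u) x,
    T.hasFDerivAt.comp x (hu.differentiable_fderiv_of_two x).hasFDerivAt, ?_⟩
  let b := (EuclideanSpace.basisFun (Fin n) ℝ).toBasis
  rw [ContinuousLinearMap.det, ← LinearMap.det_toMatrix b]
  congr 1
  ext i j
  rw [LinearMap.toMatrix_apply, hessianMatrix_apply hu]
  have h : (T (fderiv ℝ (fderiv ℝ u) x (EuclideanSpace.single j 1))) i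
      = ⟪T (fderiv ℝ (fderiv ℝ u) x (EuclideanSpace.single j 1)),
          EuclideanSpace.single i (1 : ℝ)⟫ := by
    simp [EuclideanSpace.inner_single_right]
  simp only [b, OrthonormalBasis.coe_toBasis, EuclideanSpace.basisFun_apply,
    OrthonormalBasis.coe_toBasis_repr_apply, EuclideanSpace.basisFun_repr]
  refine h.trans ?_
  exact InnerProductSpace.toDual_symm_apply

/-- Alexandrov's argument: if `u - ⟪p, ·⟫` exceeds its boundary values on `U` at `y` by more than
`D * r`, then every slope in the ball of radius `r` about `p` is the gradient of `u` at an interior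
maximum of `u` minus a linear function; the area formula bounds the volume of these slopes. -/
theorem volume_ball_le_lintegral_concaveDet_hessianMatrix {n : ℕ}
    {u : EuclideanSpace ℝ (Fin n) → ℝ} (hu : ContDiff ℝ 2 u) {U : Set (EuclideanSpace ℝ (Fin n))}
    (hU : IsOpen U) (hUb : Bornology.IsBounded U) {y p : EuclideanSpace ℝ (Fin n)} (hy : y ∈ U)
    {m D r : ℝ} (hm : ∀ x ∈ frontier U, u x - ⟪p, x⟫ ≤ m) (hD : ∀ x ∈ frontier U, dist x y ≤ D)
    (hr : 0 ≤ r) (hyr : m + r * D < u y - ⟪p, y⟫) :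
    volume (ball p r) ≤ ∫⁻ x in U, concaveDet (hessianMatrix u x) := by
  classical
  choose A hA hdet using fun x => hasFDerivAt_gradient hu x
  set Γ : Set (EuclideanSpace ℝ (Fin n)) := {x | (-hessianMatrix u x).PosSemidef} with hΓ
  have hcont : Continuous fun x => -hessianMatrix u x :=
    (continuous_pi fun i => continuous_pi fun j => continuous_hessianMatrix_apply hu i j :
      Continuous fun x => hessianMatrix u x).neg
  have hΓc : IsClosed Γ := Matrix.isClosed_setOf_posSemidef.preimage hcont
  have hsub : ball p r ⊆ gradient u '' (U ∩ Γ) := by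
    intro ξ hξ
    set f : EuclideanSpace ℝ (Fin n) → ℝ := fun x => u x - ⟪ξ, x⟫ with hf
    have hfc : ContDiff ℝ 2 f := hu.sub (contDiff_const.inner ℝ contDiff_id)
    obtain ⟨x, hx, hmax⟩ := hUb.isCompact_closure.exists_isMaxOn ⟨y, subset_closure hy⟩
      hfc.continuous.continuousOn
    have hxU : x ∈ U := by
      by_contra hxU
      have hxf : x ∈ frontier U := by
        rw [hU.frontier_eq]; exact ⟨hx, hxU⟩
      have h1 : f y ≤ f x := hmax (subset_closure hy)
      have h2 := hm x hxf
      have h3 : ⟪ξ - p, y - x⟫ ≤ r * D := by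
        refine (real_inner_le_norm _ _).trans ?_
        have h4 : ‖ξ - p‖ ≤ r := by rw [← dist_eq_norm]; exact (mem_ball.1 hξ).le
        have h5 : ‖y - x‖ ≤ D := by rw [← dist_eq_norm, dist_comm]; exact hD x hxf
        exact mul_le_mul h4 h5 (norm_nonneg _) hr
      simp only [hf] at h1
      rw [inner_sub_left, inner_sub_right, inner_sub_right] at h3
      linarith
    have hloc : IsLocalMax f x := by
      filter_upwards [hU.mem_nhds hxU] with z hz using hmax (subset_closure hz)
    have hlin : ∀ z, HasFDerivAt (fun x => ⟪ξ, x⟫) (innerSL ℝ ξ) z := fun z =>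
      (innerSL ℝ ξ).hasFDerivAt
    have hudiff : ∀ z, HasFDerivAt u (fderiv ℝ u z) z := fun z =>
      (hu.differentiable two_ne_zero z).hasFDerivAt
    have hf1 : fderiv ℝ f = fun z => fderiv ℝ u z - innerSL ℝ ξ :=
      funext fun z => ((hudiff z).sub (hlin z)).fderiv
    refine ⟨x, ⟨hxU, posSemidef_neg_hessianMatrix hu fun e => ?_⟩, ?_⟩
    · have := hloc.fderiv_fderiv_apply_self_nonpos hfc e
      rwa [hf1, fderiv_sub_const] at this
    · have h0 := hloc.fderiv_eq_zero
      rw [hf1] at h0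
      have h1 : HasGradientAt u ξ x := by
        rw [hasGradientAt_iff_hasFDerivAt]
        have h2 := hudiff x
        rw [sub_eq_zero.1 h0] at h2
        exact h2
      exact h1.gradient
  calc volume (ball p r) ≤ volume (gradient u '' (U ∩ Γ)) := measure_mono hsub
    _ ≤ ∫⁻ x in U ∩ Γ, ENNReal.ofReal |(A x).det| :=
        addHaar_image_le_lintegral_abs_det_fderiv volume (hU.measurableSet.inter hΓc.measurableSet)
          fun x _ => (hA x).hasFDerivWithinAt
    _ = ∫⁻ x in U ∩ Γ, concaveDet (hessianMatrix u x) := by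
        refine setLIntegral_congr_fun (hU.measurableSet.inter hΓc.measurableSet) fun x hx => ?_
        have hx2 : (-hessianMatrix u x).PosSemidef := hx.2
        have h1 : |(hessianMatrix u x).det| = (-hessianMatrix u x).det := by
          rw [← abs_of_nonneg hx2.det_nonneg, Matrix.det_neg, abs_mul]
          simp
        simp only [hdet, concaveDet, if_pos hx2, h1]
    _ ≤ _ := lintegral_mono_set inter_subset_left

/-! ### Mollification -/

variable {n : ℕ}

/-- The mollification of `f` by the normalized bump function `ρ`. -/
noncomputable def mollify {n : ℕ} (ρ : ContDiffBump (0 : EuclideanSpace ℝ (Fin n)))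
    (f : EuclideanSpace ℝ (Fin n) → ℝ) : EuclideanSpace ℝ (Fin n) → ℝ :=
  (ρ.normed volume ⋆[ContinuousLinearMap.lsmul ℝ ℝ, volume] f)

theorem convolutionExists_normed (ρ : ContDiffBump (0 : EuclideanSpace ℝ (Fin n)))
    {f : EuclideanSpace ℝ (Fin n) → ℝ} (hf : LocallyIntegrable f) :
    ConvolutionExists (ρ.normed volume) f (ContinuousLinearMap.lsmul ℝ ℝ) volume :=
  ρ.hasCompactSupport_normed.convolutionExists_left _ ρ.continuous_normed hf

theorem mollify_add (ρ : ContDiffBump (0 : EuclideanSpace ℝ (Fin n)))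
    {f g : EuclideanSpace ℝ (Fin n) → ℝ} (hf : LocallyIntegrable f) (hg : LocallyIntegrable g) :
    mollify ρ (f + g) = mollify ρ f + mollify ρ g :=
  (convolutionExists_normed ρ hf).distrib_add (convolutionExists_normed ρ hg)

/-- Jensen's inequality for the probability measure with density `ρ`. -/
theorem enorm_mollify_pow_le (hn : 1 ≤ n) (ρ : ContDiffBump (0 : EuclideanSpace ℝ (Fin n)))
    {f : EuclideanSpace ℝ (Fin n) → ℝ} (hf : AEStronglyMeasurable f)
    (x : EuclideanSpace ℝ (Fin n)) :
    ‖mollify ρ f x‖ₑ ^ n ≤ ∫⁻ t, ENNReal.ofReal (ρ.normed volume t) * ‖f (x - t)‖ₑ ^ n := by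
  set w : EuclideanSpace ℝ (Fin n) → ℝ≥0∞ := fun t => ENNReal.ofReal (ρ.normed volume t)
  have hw : Measurable w := ENNReal.measurable_ofReal.comp ρ.continuous_normed.measurable
  set ν := volume.withDensity w with hν
  have : IsProbabilityMeasure ν := ⟨by
    rw [hν, withDensity_apply _ MeasurableSet.univ, Measure.restrict_univ,
      ← ofReal_integral_eq_lintegral_ofReal ρ.integrable_normed
        (Eventually.of_forall ρ.nonneg_normed), ρ.integral_normed, ENNReal.ofReal_one]⟩
  have hfx : AEStronglyMeasurable (fun t => f (x - t)) volume :=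
    hf.comp_quasiMeasurePreserving (quasiMeasurePreserving_sub_left volume x)
  have hfν : AEStronglyMeasurable (fun t => f (x - t)) ν :=
    hfx.mono_ac (withDensity_absolutelyContinuous _ _)
  have h1 : ‖mollify ρ f x‖ₑ ≤ eLpNorm (fun t => f (x - t)) 1 ν := by
    rw [eLpNorm_one_eq_lintegral_enorm, hν, lintegral_withDensity_eq_lintegral_mul₀ hw.aemeasurable
      hfx.enorm]
    refine (enorm_integral_le_lintegral_enorm _).trans (lintegral_mono fun t => ?_)
    simp [w, enorm_mul, Real.enorm_eq_ofReal (ρ.nonneg_normed t)]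
  calc ‖mollify ρ f x‖ₑ ^ n ≤ eLpNorm (fun t => f (x - t)) n ν ^ n := by
        gcongr
        exact h1.trans (eLpNorm_le_eLpNorm_of_exponent_le (by exact_mod_cast hn) hfν)
    _ = ∫⁻ t, ‖f (x - t)‖ₑ ^ n ∂ν := (lintegral_enorm_pow_eq_eLpNorm_pow hn _).symm
    _ = _ := by
        rw [hν, lintegral_withDensity_eq_lintegral_mul₀ hw.aemeasurable (hfx.enorm.pow_const n)]
        rfl

/-- Mollification does not increase the `L^n` norm. -/
theorem eLpNorm_mollify_le (hn : 1 ≤ n) (ρ : ContDiffBump (0 : EuclideanSpace ℝ (Fin n)))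
    {f : EuclideanSpace ℝ (Fin n) → ℝ} (hf : AEStronglyMeasurable f) :
    eLpNorm (mollify ρ f) n volume ≤ eLpNorm f n volume := by
  have hw : Measurable fun t => ENNReal.ofReal (ρ.normed volume t) :=
    ENNReal.measurable_ofReal.comp ρ.continuous_normed.measurable
  have hw1 : ∫⁻ t, ENNReal.ofReal (ρ.normed volume t) = 1 := by
    rw [← ofReal_integral_eq_lintegral_ofReal ρ.integrable_normed
        (Eventually.of_forall ρ.nonneg_normed), ρ.integral_normed, ENNReal.ofReal_one]
  have hprod : AEMeasurable (Function.uncurry fun x t =>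
      ENNReal.ofReal (ρ.normed volume t) * ‖f (x - t)‖ₑ ^ n) (volume.prod volume) := by
    refine (hw.comp measurable_snd).aemeasurable.mul ?_
    exact (hf.comp_quasiMeasurePreserving
      (quasiMeasurePreserving_sub_of_right_invariant volume volume)).enorm.pow_const n
  refine (ENNReal.pow_right_strictMono (by omega : n ≠ 0)).le_iff_le.1 ?_
  rw [← lintegral_enorm_pow_eq_eLpNorm_pow hn, ← lintegral_enorm_pow_eq_eLpNorm_pow hn]
  calc ∫⁻ x, ‖mollify ρ f x‖ₑ ^ n
      ≤ ∫⁻ x, ∫⁻ t, ENNReal.ofReal (ρ.normed volume t) * ‖f (x - t)‖ₑ ^ n :=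
        lintegral_mono fun x => enorm_mollify_pow_le hn ρ hf x
    _ = ∫⁻ t, ∫⁻ x, ENNReal.ofReal (ρ.normed volume t) * ‖f (x - t)‖ₑ ^ n :=
        lintegral_lintegral_swap hprod
    _ = ∫⁻ t, ENNReal.ofReal (ρ.normed volume t) * ∫⁻ x, ‖f x‖ₑ ^ n := by
        refine lintegral_congr fun t => ?_
        rw [lintegral_const_mul' _ _ ENNReal.ofReal_ne_top,
          lintegral_sub_right_eq_self (fun x => ‖f x‖ₑ ^ n) t]
    _ = ∫⁻ x, ‖f x‖ₑ ^ n := by rw [lintegral_mul_const _ hw, hw1, one_mul]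

/-- Mollifications converge in `L^n` on sets of finite measure. -/
theorem tendsto_eLpNorm_mollify_sub (hn : 1 ≤ n)
    {ρ : ℕ → ContDiffBump (0 : EuclideanSpace ℝ (Fin n))}
    (hρ : Tendsto (fun k => (ρ k).rOut) atTop (𝓝 0)) {f : EuclideanSpace ℝ (Fin n) → ℝ}
    (hf : MemLp f n) {K : Set (EuclideanSpace ℝ (Fin n))} (hK : volume K ≠ ⊤) :
    Tendsto (fun k => eLpNorm (fun x => mollify (ρ k) f x - f x) n (volume.restrict K)) atTop
      (𝓝 0) := by
  have hn1 : (1 : ℝ≥0∞) ≤ n := by exact_mod_cast hn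
  rw [ENNReal.tendsto_nhds_zero]
  intro ε hε
  have hε3 : ε / 3 ≠ 0 := (ENNReal.div_pos hε.ne' (by simp)).ne'
  obtain ⟨g, hgs, hfg, hgc, hgm⟩ :=
    hf.exists_hasCompactSupport_eLpNorm_sub_le (ENNReal.natCast_ne_top n) hε3
  have hfl : LocallyIntegrable f := hf.locallyIntegrable hn1
  have hgl : LocallyIntegrable g := hgm.locallyIntegrable hn1
  -- A uniform error that contributes at most `ε / 3` to the norm over `K`.
  obtain ⟨η, hη, hηK⟩ : ∃ η : ℝ, 0 < η ∧
      volume.restrict K univ ^ ((n : ℝ≥0∞).toReal)⁻¹ * ENNReal.ofReal η ≤ ε / 3 := by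
    have hc : volume.restrict K univ ^ ((n : ℝ≥0∞).toReal)⁻¹ ≠ ⊤ := by
      rw [Measure.restrict_apply_univ]
      exact ENNReal.rpow_ne_top_of_nonneg (by positivity) hK
    have h1 : Tendsto (fun η : ℝ => volume.restrict K univ ^ ((n : ℝ≥0∞).toReal)⁻¹ *
        ENNReal.ofReal η) (𝓝[>] 0) (𝓝 0) := by
      have h2 : Tendsto (fun η : ℝ => ENNReal.ofReal η) (𝓝[>] 0) (𝓝 0) := by
        have := (ENNReal.continuous_ofReal.tendsto 0).mono_left
          (nhdsWithin_le_nhds (s := Ioi (0 : ℝ)))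
        simpa using this
      simpa using ENNReal.Tendsto.const_mul h2 (Or.inr hc)
    have h3 := h1.eventually (ge_mem_nhds (pos_iff_ne_zero.2 hε3))
    obtain ⟨η, h4, h5⟩ := (h3.and self_mem_nhdsWithin).exists
    exact ⟨η, h5, h4⟩
  obtain ⟨τ, hτ, hgu⟩ := Metric.uniformContinuous_iff.1 (hgs.uniformContinuous_of_continuous hgc) η hη
  filter_upwards [hρ.eventually (gt_mem_nhds hτ)] with k hk
  have hdecomp : (fun x => mollify (ρ k) f x - f x) =
      (mollify (ρ k) (f - g) + fun x => mollify (ρ k) g x - g x) + (g - f) := by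
    have h1 : mollify (ρ k) f = mollify (ρ k) (f - g) + mollify (ρ k) g := by
      rw [← mollify_add _ (hfl.sub hgl) hgl, sub_add_cancel]
    ext x
    simp only [h1, Pi.add_apply, Pi.sub_apply]
    ring
  have hmoll : ∀ h : EuclideanSpace ℝ (Fin n) → ℝ, LocallyIntegrable h →
      AEStronglyMeasurable (mollify (ρ k) h) (volume.restrict K) := fun h hh =>
    ((ρ k).hasCompactSupport_normed.continuous_convolution_left _
      (ρ k).continuous_normed hh).aestronglyMeasurable
  have hm1 := hmoll _ (hfl.sub hgl)
  have hm2 : AEStronglyMeasurable (fun x => mollify (ρ k) g x - g x) (volume.restrict K) :=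
    (hmoll _ hgl).sub hgc.aestronglyMeasurable
  have hm3 : AEStronglyMeasurable (g - f) (volume.restrict K) :=
    (hgm.aestronglyMeasurable.sub hf.aestronglyMeasurable).restrict
  rw [hdecomp]
  calc _ ≤ eLpNorm (mollify (ρ k) (f - g)) n (volume.restrict K)
        + eLpNorm (fun x => mollify (ρ k) g x - g x) n (volume.restrict K)
        + eLpNorm (g - f) n (volume.restrict K) := by
        refine (eLpNorm_add_le (hm1.add hm2) hm3 hn1).trans ?_
        gcongr
        exact eLpNorm_add_le hm1 hm2 hn1
    _ ≤ ε / 3 + ε / 3 + ε / 3 := by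
        gcongr
        · refine (eLpNorm_mono_measure _ Measure.restrict_le_self).trans
            ((eLpNorm_mollify_le hn _ (hf.aestronglyMeasurable.sub
              hgm.aestronglyMeasurable)).trans hfg)
        · refine (eLpNorm_le_of_ae_bound (C := η) (Eventually.of_forall fun x => ?_)).trans hηK
          rw [← dist_eq_norm]
          refine ContDiffBump.dist_normed_convolution_le hgc.aestronglyMeasurable fun y hy => ?_
          exact (hgu ((mem_ball.1 hy).trans hk)).le
        · rw [eLpNorm_sub_comm]
          exact (eLpNorm_mono_measure _ Measure.restrict_le_self).trans hfg
    _ = ε := ENNReal.add_thirds ε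

theorem contDiff_mollify (ρ : ContDiffBump (0 : EuclideanSpace ℝ (Fin n)))
    {f : EuclideanSpace ℝ (Fin n) → ℝ} (hf : LocallyIntegrable f) : ContDiff ℝ 2 (mollify ρ f) :=
  ρ.hasCompactSupport_normed.contDiff_convolution_left (n := 2) _ ρ.contDiff_normed hf

theorem fderiv_convolution_apply {ψ f : EuclideanSpace ℝ (Fin n) → ℝ} (hψ : ContDiff ℝ ∞ ψ)
    (hψs : HasCompactSupport ψ) (hf : LocallyIntegrable f) (x e : EuclideanSpace ℝ (Fin n)) :
    fderiv ℝ (ψ ⋆[ContinuousLinearMap.lsmul ℝ ℝ, volume] f) x e =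
      ((fun y => fderiv ℝ ψ y e) ⋆[ContinuousLinearMap.lsmul ℝ ℝ, volume] f) x := by
  have hψ1 : ContDiff ℝ 1 ψ := hψ.of_le (by exact_mod_cast le_top)
  rw [(hψs.hasFDerivAt_convolution_left (ContinuousLinearMap.lsmul ℝ ℝ) hψ1 hf x).fderiv]
  have hex := (hψs.fderiv ℝ).convolutionExists_left
    ((ContinuousLinearMap.lsmul ℝ ℝ).precompL (EuclideanSpace ℝ (Fin n)))
    (hψ1.continuous_fderiv one_ne_zero) hf x
  simp_rw [convolution_def, ContinuousLinearMap.integral_apply hex]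
  rfl

/-- Convolution moves a derivative from the kernel to a function with a weak derivative, at points
whose distance to the complement of `K ⊆ Ω` is at least the radius of the kernel. -/
theorem HasWeakPartialDeriv.convolution_fderiv {Ω K : Set (EuclideanSpace ℝ (Fin n))} {i : Fin n}
    {u w : EuclideanSpace ℝ (Fin n) → ℝ} (h : HasWeakPartialDeriv Ω i u w)
    (hΩ : MeasurableSet Ω) (hKΩ : K ⊆ Ω) {ψ : EuclideanSpace ℝ (Fin n) → ℝ}
    (hψ : ContDiff ℝ ∞ ψ) (hψs : HasCompactSupport ψ) {x : EuclideanSpace ℝ (Fin n)}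
    (hx : ∀ t, x - t ∈ tsupport ψ → t ∈ K) :
    ((fun y => fderiv ℝ ψ y (EuclideanSpace.single i 1))
        ⋆[ContinuousLinearMap.lsmul ℝ ℝ, volume] K.indicator u) x =
      (ψ ⋆[ContinuousLinearMap.lsmul ℝ ℝ, volume] K.indicator w) x := by
  have key : ∀ (θ q : EuclideanSpace ℝ (Fin n) → ℝ), (∀ y, y ∉ tsupport ψ → θ y = 0) →
      (θ ⋆[ContinuousLinearMap.lsmul ℝ ℝ, volume] K.indicator q) x
        = ∫ t in Ω, q t * θ (x - t) := by
    intro θ q hθ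
    rw [convolution_eq_swap, ← integral_indicator hΩ]
    refine integral_congr_ae (Eventually.of_forall fun t => ?_)
    simp only [ContinuousLinearMap.lsmul_apply, smul_eq_mul]
    by_cases ht : x - t ∈ tsupport ψ
    · rw [indicator_of_mem (hx t ht), indicator_of_mem (hKΩ (hx t ht)), mul_comm]
    · by_cases htΩ : t ∈ Ω
      · simp [htΩ, hθ _ ht]
      · simp [htΩ, hθ _ ht]
  set η : EuclideanSpace ℝ (Fin n) → ℝ := fun t => ψ (x - t) with hη
  have hηsupp : tsupport η ⊆ (fun t => x - t) ⁻¹' tsupport ψ := by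
    refine closure_minimal (fun t ht => subset_tsupport ψ ht) ?_
    exact (isClosed_tsupport ψ).preimage (by fun_prop)
  have hηc : HasCompactSupport η :=
    hψs.comp_homeomorph (Homeomorph.subLeft x)
  have hηd : ContDiff ℝ ∞ η := hψ.comp (contDiff_const.sub contDiff_id)
  have hηderiv : ∀ t e, fderiv ℝ η t e = -fderiv ℝ ψ (x - t) e := by
    intro t e
    have h1 : HasFDerivAt η ((fderiv ℝ ψ (x - t)).comp
        (-ContinuousLinearMap.id ℝ (EuclideanSpace ℝ (Fin n)))) t := by
      have h2 : HasFDerivAt (fun t => x - t)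
          (-ContinuousLinearMap.id ℝ (EuclideanSpace ℝ (Fin n))) t :=
        (hasFDerivAt_id t).const_sub x
      exact ((hψ.differentiable (by simp) (x - t)).hasFDerivAt).comp t h2
    rw [h1.fderiv]
    simp
  have h3 := h.integral_eq η hηd hηc fun t ht => hKΩ (hx t (hηsupp ht))
  rw [key _ u fun y hy => ?_, key ψ w fun y hy => image_eq_zero_of_notMem_tsupport hy]
  · simp only [hηderiv, mul_neg, integral_neg, neg_inj] at h3
    exact h3
  · have : fderiv ℝ ψ y = 0 := image_eq_zero_of_notMem_tsupport
      fun hy' => hy (tsupport_fderiv_subset ℝ hy')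
    simp [this]

/-- At points well inside `K`, the Hessian of the mollification is the mollification of the weak second
derivatives. -/
theorem hessianMatrix_mollify {p : ℝ≥0∞} {Ω K : Set (EuclideanSpace ℝ (Fin n))}
    {v : EuclideanSpace ℝ (Fin n) → ℝ} {Dv : Fin n → EuclideanSpace ℝ (Fin n) → ℝ}
    {D2v : Fin n → Fin n → EuclideanSpace ℝ (Fin n) → ℝ} (h : MemSobolevTwoLoc p Ω v Dv D2v)
    (hΩ : MeasurableSet Ω) (hKΩ : K ⊆ Ω) (hvK : LocallyIntegrable (K.indicator v))
    (ρ : ContDiffBump (0 : EuclideanSpace ℝ (Fin n))) {x : EuclideanSpace ℝ (Fin n)}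
    (hx : closedBall x ρ.rOut ⊆ K) (i j : Fin n) :
    hessianMatrix (mollify ρ (K.indicator v)) x i j = mollify ρ (K.indicator (D2v i j)) x := by
  set ψ := ρ.normed (volume : Measure (EuclideanSpace ℝ (Fin n))) with hψdef
  have hψ : ContDiff ℝ ∞ ψ := ρ.contDiff_normed
  have hψs : HasCompactSupport ψ := ρ.hasCompactSupport_normed
  have hderiv : ∀ k : Fin n, ContDiff ℝ ∞ fun y => fderiv ℝ ψ y (EuclideanSpace.single k 1) :=
    fun k => (hψ.fderiv_right (m := ∞) (by simp)).clm_apply contDiff_const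
  have hsuppd : ∀ k : Fin n, tsupport (fun y => fderiv ℝ ψ y (EuclideanSpace.single k 1))
      ⊆ tsupport ψ := fun k => tsupport_fderiv_apply_subset ℝ _
  have hderivs : ∀ k : Fin n,
      HasCompactSupport fun y => fderiv ℝ ψ y (EuclideanSpace.single k 1) :=
    fun k => hψs.fderiv_apply ℝ _
  have hmem : ∀ t, x - t ∈ tsupport ψ → t ∈ K := by
    intro t ht
    rw [hψdef, ρ.tsupport_normed_eq, mem_closedBall, dist_zero_right] at ht
    refine hx ?_
    rwa [mem_closedBall, dist_comm, dist_eq_norm]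
  have h1 : ∀ k : Fin n, (fun y => fderiv ℝ (mollify ρ (K.indicator v)) y
      (EuclideanSpace.single k 1)) = ((fun y => fderiv ℝ ψ y (EuclideanSpace.single k 1))
        ⋆[ContinuousLinearMap.lsmul ℝ ℝ, volume] K.indicator v) := fun k =>
    funext fun y => fderiv_convolution_apply hψ hψs hvK y _
  have hsymm : (fun y => fderiv ℝ (fun z => fderiv ℝ ψ z (EuclideanSpace.single i 1)) y
      (EuclideanSpace.single j 1)) = fun y =>
        fderiv ℝ (fun z => fderiv ℝ ψ z (EuclideanSpace.single j 1)) y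
          (EuclideanSpace.single i 1) := by
    have hψ2 : ContDiff ℝ 2 ψ := ρ.contDiff_normed (n := 2)
    ext y
    have h2 := hessianMatrix_apply hψ2 y i j
    have h3 := hessianMatrix_apply hψ2 y j i
    have h4 : IsSymmSndFDerivAt ℝ ψ y := hψ2.contDiffAt.isSymmSndFDerivAt (by simp)
    rw [h4] at h2
    simp only [hessianMatrix, Matrix.of_apply] at h2 h3
    rw [h2, h3]
  simp only [hessianMatrix, Matrix.of_apply]
  rw [h1 i, fderiv_convolution_apply (hderiv i) (hderivs i) hvK, hsymm,
    (h.weak_deriv i).convolution_fderiv hΩ hKΩ (hderiv j) (hderivs j)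
      fun t ht => hmem t (hsuppd j ht),
    (h.weak_deriv2 i j).convolution_fderiv hΩ hKΩ hψ hψs hmem]
  rfl

/-- Mollifications of a function that is continuous on a neighbourhood of `K` converge uniformly
on `K`. -/
theorem eventually_dist_mollify_le {ρ : ℕ → ContDiffBump (0 : EuclideanSpace ℝ (Fin n))}
    (hρ : Tendsto (fun k => (ρ k).rOut) atTop (𝓝 0)) {v : EuclideanSpace ℝ (Fin n) → ℝ}
    {K K' : Set (EuclideanSpace ℝ (Fin n))} (hK' : IsCompact K') (hv : ContinuousOn v K')
    {τ : ℝ} (hτ : 0 < τ) (hKK' : ∀ x ∈ K, closedBall x τ ⊆ K') {ε : ℝ} (hε : 0 < ε) :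
    ∀ᶠ k in atTop, ∀ x ∈ K, dist (mollify (ρ k) (K'.indicator v) x) (v x) ≤ ε := by
  obtain ⟨σ, hσ, huc⟩ := Metric.uniformContinuousOn_iff.1
    (hK'.uniformContinuousOn_of_continuous hv) ε hε
  have hmeas : AEStronglyMeasurable (K'.indicator v) volume :=
    (aestronglyMeasurable_indicator_iff hK'.measurableSet).2
      (hv.aestronglyMeasurable hK'.measurableSet)
  filter_upwards [hρ.eventually (gt_mem_nhds (lt_min hτ hσ))] with k hk x hx
  have hxK' : x ∈ K' := hKK' x hx (mem_closedBall_self hτ.le)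
  have h1 : ∀ y ∈ ball x (ρ k).rOut,
      dist (K'.indicator v y) (K'.indicator v x) ≤ ε := by
    intro y hy
    have hy1 : dist y x < min τ σ := (mem_ball.1 hy).trans hk
    have hyK' : y ∈ K' := hKK' x hx (mem_closedBall.2 (hy1.le.trans (min_le_left _ _)))
    rw [indicator_of_mem hyK', indicator_of_mem hxK']
    exact (huc y hyK' x hxK' (hy1.trans_le (min_le_right _ _))).le
  have h2 := ContDiffBump.dist_normed_convolution_le (φ := ρ k) hmeas h1
  rwa [indicator_of_mem hxK'] at h2

/-! ### The Alexandrov–Bakelman–Pucci estimate in `W^{2,n}_loc` -/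

/-- The Alexandrov estimate for `W^{2,n}_loc` functions. It is applied to mollifications of `v` on
the superlevel sets of `v - ⟪p, ·⟫` above the boundary values, which are compactly contained in
`Ω`. -/
theorem MemSobolevTwoLoc.volume_ball_le (hn : 1 ≤ n) {Ω U : Set (EuclideanSpace ℝ (Fin n))}
    {v : EuclideanSpace ℝ (Fin n) → ℝ} {Dv : Fin n → EuclideanSpace ℝ (Fin n) → ℝ}
    {D2v : Fin n → Fin n → EuclideanSpace ℝ (Fin n) → ℝ} (h : MemSobolevTwoLoc n Ω v Dv D2v)
    (hΩ : IsOpen Ω) (hvΩ : ContinuousOn v Ω) (hU : IsOpen U) (hUb : Bornology.IsBounded U)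
    (hUΩ : U ⊆ Ω) (hvU : ContinuousOn v (closure U)) {y p : EuclideanSpace ℝ (Fin n)}
    (hy : y ∈ U) {m D r : ℝ} (hm : ∀ x ∈ frontier U, v x - ⟪p, x⟫ ≤ m)
    (hD : ∀ x ∈ U, dist x y ≤ D) (hr : 0 ≤ r) (hyr : m + r * D < v y - ⟪p, y⟫) :
    volume (ball p r) ≤ ∫⁻ x in Ω, concaveDet (Matrix.of fun i j => D2v i j x) := by
  obtain ⟨ε, hε, hyε⟩ : ∃ ε : ℝ, 0 < ε ∧ m + r * D + 4 * ε = v y - ⟪p, y⟫ :=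
    ⟨(v y - ⟪p, y⟫ - (m + r * D)) / 4, by linarith, by ring⟩
  set q : EuclideanSpace ℝ (Fin n) → ℝ := fun x => v x - ⟪p, x⟫ with hq
  have hqc : ContinuousOn q (closure U) := hvU.sub (by fun_prop)
  set V := U ∩ q ⁻¹' Ioi (m + ε) with hV
  set K := closure U ∩ q ⁻¹' Ici (m + ε) with hK
  have hVo : IsOpen V := (hqc.mono subset_closure).isOpen_inter_preimage hU isOpen_Ioi
  have hKclosed : IsClosed K := hqc.preimage_isClosed_of_isClosed isClosed_closure isClosed_Ici
  have hKc : IsCompact K := hUb.isCompact_closure.of_isClosed_subset hKclosed inter_subset_left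
  have hVK : V ⊆ K := fun x hx =>
    ⟨subset_closure hx.1, mem_preimage.2 (mem_Ici.2 (mem_Ioi.1 (mem_preimage.1 hx.2)).le)⟩
  have hKU : K ⊆ U := by
    intro x hx
    by_contra hxU
    have h1 := hm x (by rw [hU.frontier_eq]; exact ⟨hx.1, hxU⟩)
    have h2 : m + ε ≤ q x := hx.2
    simp only [hq] at h2
    linarith
  have hrD : 0 ≤ r * D := mul_nonneg hr (by simpa using hD y hy)
  have hyV : y ∈ V := ⟨hy, by simp only [hq, mem_preimage, mem_Ioi]; linarith⟩
  obtain ⟨τ, hτ, hτK⟩ := hKc.exists_cthickening_subset_open hΩ (hKU.trans hUΩ)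
  set K' := cthickening τ K with hK'
  have hK'c : IsCompact K' := hKc.cthickening
  have hball : ∀ x ∈ K, closedBall x τ ⊆ K' := fun x hx => closedBall_subset_cthickening hx τ
  have hKK' : K ⊆ K' := self_subset_cthickening K
  let ρ : ℕ → ContDiffBump (0 : EuclideanSpace ℝ (Fin n)) := fun k =>
    ⟨1 / ((k : ℝ) + 1) / 2, 1 / ((k : ℝ) + 1), by positivity, half_lt_self (by positivity)⟩
  have hρ : Tendsto (fun k => (ρ k).rOut) atTop (𝓝 0) := tendsto_one_div_add_atTop_nhds_zero_nat
  have hρ2 : ∀ k, (ρ k).rOut ≤ 2 * (ρ k).rIn := fun k => by simp only [ρ]; linarith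
  have hvint : LocallyIntegrable (K'.indicator v) := by
    refine Integrable.locallyIntegrable ?_
    exact (integrable_indicator_iff hK'c.measurableSet).2
      ((hvΩ.mono hτK).integrableOn_compact hK'c)
  have hmem : ∀ i j, MemLp (K'.indicator (D2v i j)) n volume := fun i j =>
    (memLp_indicator_iff_restrict hK'c.measurableSet).2 (h.memLpLoc_deriv2 i j K' hK'c hτK)
  have hn1 : (1 : ℝ≥0∞) ≤ n := by exact_mod_cast hn
  have hτev : ∀ᶠ k in atTop, (ρ k).rOut < τ := hρ.eventually (gt_mem_nhds hτ)
  set u : ℕ → EuclideanSpace ℝ (Fin n) → ℝ := fun k => mollify (ρ k) (K'.indicator v) with hu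
  have hhess : ∀ᶠ k in atTop, ∀ x ∈ V, ∀ i j,
      hessianMatrix (u k) x i j = mollify (ρ k) (K'.indicator (D2v i j)) x := by
    filter_upwards [hτev] with k hk x hx i j
    exact hessianMatrix_mollify h hΩ.measurableSet hτK hvint (ρ k)
      ((closedBall_subset_closedBall hk.le).trans (hball x (hVK hx))) i j
  have hind : ∀ x ∈ V, ∀ i j, K'.indicator (D2v i j) x = D2v i j x := fun x hx i j =>
    indicator_of_mem (hKK' (hVK hx)) _
  have hsmooth : ∀ᶠ k in atTop,
      volume (ball p r) ≤ ∫⁻ x in V, concaveDet (hessianMatrix (u k) x) := by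
    filter_upwards [eventually_dist_mollify_le hρ hK'c (hvΩ.mono hτK) hτ hball hε] with k hk
    refine volume_ball_le_lintegral_concaveDet_hessianMatrix (m := m + 2 * ε) (D := D)
      (contDiff_mollify (ρ k) hvint) hVo (hUb.subset inter_subset_left) hyV ?_ ?_ hr ?_
    · intro x hx
      rw [hVo.frontier_eq] at hx
      have hxK : x ∈ K := closure_minimal hVK hKclosed hx.1
      have h1 : q x ≤ m + ε := by
        by_contra! hlt
        exact hx.2 ⟨hKU hxK, hlt⟩
      have h2 := (abs_le.1 (hk x hxK)).2
      simp only [hq] at h1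
      linarith
    · intro x hx
      rw [hVo.frontier_eq] at hx
      exact hD x (hKU (closure_minimal hVK hKclosed hx.1))
    · have h2 := (abs_le.1 (hk y (hVK hyV))).1
      linarith
  have hlim := le_lintegral_concaveDet_of_tendsto (μ := volume.restrict V) hn
    (M := fun k => hessianMatrix (u k)) (M₀ := fun x => Matrix.of fun i j => D2v i j x)
    (fun k i j => (continuous_hessianMatrix_apply (contDiff_mollify (ρ k) hvint) i j).measurable)
    (fun i j => (h.memLpLoc_deriv2 i j K hKc (hKU.trans hUΩ)).mono_measure
      (Measure.restrict_mono hVK le_rfl))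
    (fun i j => ?_) (fun i j => ?_) hsmooth
  · exact hlim.trans (lintegral_mono_set (inter_subset_left.trans hUΩ))
  · have hae := ContDiffBump.ae_convolution_tendsto_right_of_locallyIntegrable (μ := volume)
      (φ := ρ) hρ (Eventually.of_forall hρ2) ((hmem i j).locallyIntegrable hn1)
    filter_upwards [ae_restrict_of_ae hae, ae_restrict_mem hVo.measurableSet] with x hx hxV
    rw [hind x hxV] at hx
    refine hx.congr' ?_
    filter_upwards [hhess] with k hk
    exact (hk x hxV i j).symm
  · have hVfin : volume V ≠ ⊤ := ((hUb.subset inter_subset_left).measure_lt_top).ne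
    refine (tendsto_eLpNorm_mollify_sub hn hρ (hmem i j) hVfin).congr' ?_
    filter_upwards [hhess] with k hk
    refine eLpNorm_congr_ae ?_
    filter_upwards [ae_restrict_mem hVo.measurableSet] with x hxV
    rw [hind x hxV, ← hk x hxV i j]
    rfl

/-- The constant in the Alexandrov–Bakelman–Pucci estimate: `1 / (n (λ ω) ^ (1 / n))`, where `ω` is the
volume of the unit ball. -/
noncomputable def abpConst (n : ℕ) (lam : ℝ) : ℝ :=
  (1 / (lam * n ^ n) / volume.real (ball (0 : EuclideanSpace ℝ (Fin n)) 1)) ^ (1 / (n : ℝ))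

theorem abpConst_nonneg {lam : ℝ} (hlam : 0 < lam) : 0 ≤ abpConst n lam := by
  unfold abpConst
  positivity

/-- The **Alexandrov–Bakelman–Pucci maximum principle**, comparing `v` with a linear function. -/
theorem MemSobolevTwoLoc.sub_inner_le (hn : 1 ≤ n) {lam : ℝ} (hlam : 0 < lam)
    {Ω U : Set (EuclideanSpace ℝ (Fin n))}
    {a : EuclideanSpace ℝ (Fin n) → Matrix (Fin n) (Fin n) ℝ}
    {g v : EuclideanSpace ℝ (Fin n) → ℝ} {Dv : Fin n → EuclideanSpace ℝ (Fin n) → ℝ}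
    {D2v : Fin n → Fin n → EuclideanSpace ℝ (Fin n) → ℝ} (h : MemSobolevTwoLoc n Ω v Dv D2v)
    (ha : ∀ᵐ x ∂(volume.restrict Ω), (a x).PosDef ∧ lam ≤ (a x).det)
    (hg : MemLp g n (volume.restrict Ω))
    (heq : ∀ᵐ x ∂(volume.restrict Ω), ∑ i, ∑ j, a x i j * D2v i j x = g x)
    (hΩ : IsOpen Ω) (hvΩ : ContinuousOn v Ω) (hU : IsOpen U) (hUb : Bornology.IsBounded U)
    (hUΩ : U ⊆ Ω) (hvU : ContinuousOn v (closure U)) {y p : EuclideanSpace ℝ (Fin n)}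
    (hy : y ∈ U) {m D : ℝ} (hm : ∀ x ∈ frontier U, v x - ⟪p, x⟫ ≤ m)
    (hD : ∀ x ∈ U, dist x y ≤ D) :
    v y - ⟪p, y⟫ ≤ m + D * (abpConst n lam * lpNormOn n Ω g) := by
  have hn' : (0 : ℝ) < n := by exact_mod_cast hn
  have : Nonempty (Fin n) := ⟨⟨0, hn⟩⟩
  set N := lpNormOn n Ω g with hN
  have hN0 : 0 ≤ N := ENNReal.toReal_nonneg
  set c := abpConst n lam with hc
  have hc0 : 0 ≤ c := abpConst_nonneg hlam
  have hD0 : 0 ≤ D := by simpa using hD y hy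
  by_contra! hlt
  obtain ⟨s, hs, hlt2⟩ : ∃ s : ℝ, 0 < s ∧ m + (c * N + s) * D < v y - ⟪p, y⟫ := by
    refine ⟨(v y - ⟪p, y⟫ - (m + D * (c * N))) / (D + 1), by
      apply div_pos <;> linarith, ?_⟩
    set t := v y - ⟪p, y⟫ - (m + D * (c * N)) with ht
    have ht0 : 0 < t := by linarith
    have h1 : t / (D + 1) * D < t := by
      rw [div_mul_eq_mul_div, div_lt_iff₀ (by linarith)]
      nlinarith
    nlinarith
  have hr0 : 0 ≤ c * N + s := by positivity
  have h1 := h.volume_ball_le hn hΩ hvΩ hU hUb hUΩ hvU hy hm hD hr0 hlt2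
  have h2 : ∫⁻ x in Ω, concaveDet (Matrix.of fun i j => D2v i j x)
      ≤ ENNReal.ofReal (1 / (lam * n ^ n) * N ^ n) := by
    calc _ ≤ ∫⁻ x in Ω, ENNReal.ofReal (1 / (lam * n ^ n)) * ‖g x‖ₑ ^ n := by
          refine lintegral_mono_ae ?_
          filter_upwards [ha, heq] with x hx hx2
          exact concaveDet_le_of_sum_eq hn hlam hx.1 hx.2 hx2
      _ = _ := by
          rw [lintegral_const_mul' _ _ ENNReal.ofReal_ne_top, lintegral_enorm_pow_eq_eLpNorm_pow hn,
            ENNReal.ofReal_mul (by positivity), ENNReal.ofReal_pow hN0, hN, lpNormOn,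
            ENNReal.ofReal_toReal hg.eLpNorm_ne_top]
  have hω : 0 < volume.real (ball (0 : EuclideanSpace ℝ (Fin n)) 1) :=
    ENNReal.toReal_pos (isOpen_ball.measure_pos _ ⟨0, by simp⟩).ne'
      (measure_ball_lt_top).ne
  have h3 : (c * N + s) ^ n * volume.real (ball (0 : EuclideanSpace ℝ (Fin n)) 1)
      ≤ 1 / (lam * n ^ n) * N ^ n := by
    have h4 := ENNReal.toReal_le_of_le_ofReal (by positivity) (h1.trans h2)
    rw [Measure.addHaar_ball _ _ hr0, ENNReal.toReal_mul, ENNReal.toReal_ofReal (by positivity),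
      finrank_euclideanSpace_fin] at h4
    exact h4
  have hcn : c ^ n = 1 / (lam * n ^ n) / volume.real (ball (0 : EuclideanSpace ℝ (Fin n)) 1) := by
    rw [hc, abpConst, one_div (n : ℝ), Real.rpow_inv_natCast_pow (by positivity) (by omega)]
  have h5 : (c * N + s) ^ n ≤ (c * N) ^ n := by
    rw [mul_pow c, hcn, div_mul_eq_mul_div, le_div_iff₀ hω]
    exact h3
  have h6 : (c * N) ^ n < (c * N + s) ^ n :=
    pow_lt_pow_left₀ (by linarith) (by positivity) (by omega)
  linarith

/-! ### The barrier argument at the boundary -/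

/-- The linear barrier: `e` points from `x₀` to the centre of the enclosing ball. -/
theorem IsUniformlyConvexDomain.exists_inner_ge {R : ℝ} {Ω : Set (EuclideanSpace ℝ (Fin n))}
    (h : IsUniformlyConvexDomain R Ω) {x₀ : EuclideanSpace ℝ (Fin n)} (hx₀ : x₀ ∈ frontier Ω) :
    ∃ e : EuclideanSpace ℝ (Fin n), ‖e‖ = R ∧ ∀ x ∈ closure Ω, ‖x - x₀‖ ^ 2 / 2 ≤ ⟪e, x - x₀⟫ := by
  obtain ⟨z, hz, hsub⟩ := h.enclosing_ball x₀ hx₀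
  have hnorm : ‖z - x₀‖ = R := by rw [← hz, dist_comm, dist_eq_norm]
  refine ⟨z - x₀, hnorm, fun x hx => ?_⟩
  have h1 : ‖(x - x₀) - (z - x₀)‖ ≤ R := by
    rw [sub_sub_sub_cancel_right, ← dist_eq_norm]
    exact closure_minimal hsub isClosed_closedBall hx
  have h2 := norm_sub_sq_real (x - x₀) (z - x₀)
  have h3 : ‖(x - x₀) - (z - x₀)‖ ^ 2 ≤ R ^ 2 := pow_le_pow_left₀ (norm_nonneg _) h1 2
  rw [hnorm, real_inner_comm] at h2
  linarith

theorem abs_le_sSup_absValues {α : ℝ} {S : Set (EuclideanSpace ℝ (Fin n))}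
    {φ : EuclideanSpace ℝ (Fin n) → ℝ} (h : MemHolderOn α S φ) {x : EuclideanSpace ℝ (Fin n)}
    (hx : x ∈ S) : |φ x| ≤ sSup (absValues S φ) :=
  le_csSup h.1 ⟨x, hx, rfl⟩

theorem sSup_absValues_nonneg (S : Set (EuclideanSpace ℝ (Fin n)))
    (φ : EuclideanSpace ℝ (Fin n) → ℝ) : 0 ≤ sSup (absValues S φ) := by
  refine Real.sSup_nonneg ?_
  rintro r ⟨x, -, rfl⟩
  exact abs_nonneg _

theorem sSup_holderQuotients_nonneg (α : ℝ) (S : Set (EuclideanSpace ℝ (Fin n)))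
    (φ : EuclideanSpace ℝ (Fin n) → ℝ) : 0 ≤ sSup (holderQuotients α S φ) := by
  refine Real.sSup_nonneg ?_
  rintro r ⟨x, -, y, -, -, rfl⟩
  positivity

theorem abs_sub_le_sSup_holderQuotients_mul {α : ℝ} {S : Set (EuclideanSpace ℝ (Fin n))}
    {φ : EuclideanSpace ℝ (Fin n) → ℝ} (h : MemHolderOn α S φ) {x y : EuclideanSpace ℝ (Fin n)}
    (hx : x ∈ S) (hy : y ∈ S) :
    |φ x - φ y| ≤ sSup (holderQuotients α S φ) * ‖x - y‖ ^ α := by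
  rcases eq_or_ne x y with rfl | hxy
  · rw [sub_self, abs_zero]
    exact mul_nonneg (sSup_holderQuotients_nonneg α S φ) (Real.rpow_nonneg (norm_nonneg _) _)
  · rw [← div_le_iff₀ (Real.rpow_pos_of_pos (norm_pos_iff.2 (sub_ne_zero.2 hxy)) _)]
    exact le_csSup h.2 ⟨x, hx, y, hy, hxy, rfl⟩

/-- The constant in the boundary Hölder estimate. -/
noncomputable def boundaryHolderConst (n : ℕ) (lam d R : ℝ) : ℝ :=
  1 + 2 * |R| * (2 + |d| * abpConst n lam) + 2 * abpConst n lam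

theorem boundaryHolderConst_pos {lam : ℝ} (hlam : 0 < lam) (d R : ℝ) :
    0 < boundaryHolderConst n lam d R := by
  have := abpConst_nonneg (n := n) hlam
  unfold boundaryHolderConst
  positivity

/-- The upper half of the boundary Hölder estimate. On `Ω ∩ B_r(x₀)` the solution is compared with
`φ x₀ + [φ]_α r ^ α + K ⟪e, · - x₀⟫`, where `⟪e, x - x₀⟫ ≥ |x - x₀|² / 2` by uniform convexity and
`K` is of order `r⁻²`. The radius `r = |x - x₀| ^ (1 / (α + 2))` balances the error terms `r ^ α` and
`r⁻² |x - x₀|`. -/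
theorem MemSobolevTwoLoc.sub_le_rpow (hn : 1 ≤ n) {lam α d R : ℝ} (hlam : 0 < lam) (hα : 0 < α)
    (hα1 : α < 1) {Ω : Set (EuclideanSpace ℝ (Fin n))} (hΩ : IsUniformlyConvexDomain R Ω)
    (hd : diam Ω ≤ d) {a : EuclideanSpace ℝ (Fin n) → Matrix (Fin n) (Fin n) ℝ}
    {g φ v : EuclideanSpace ℝ (Fin n) → ℝ} {Dv : Fin n → EuclideanSpace ℝ (Fin n) → ℝ}
    {D2v : Fin n → Fin n → EuclideanSpace ℝ (Fin n) → ℝ} (h : MemSobolevTwoLoc n Ω v Dv D2v)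
    (ha : ∀ᵐ x ∂(volume.restrict Ω), (a x).PosDef ∧ lam ≤ (a x).det)
    (hg : MemLp g n (volume.restrict Ω)) (hφ : MemHolderOn α (frontier Ω) φ)
    (hv : ContinuousOn v (closure Ω))
    (heq : ∀ᵐ x ∂(volume.restrict Ω), ∑ i, ∑ j, a x i j * D2v i j x = g x)
    (hvφ : ∀ x ∈ frontier Ω, v x = φ x) {x₀ x : EuclideanSpace ℝ (Fin n)}
    (hx₀ : x₀ ∈ frontier Ω) (hx : x ∈ Ω) (hxx₀ : ‖x - x₀‖ < 1) :
    v x - v x₀ ≤ boundaryHolderConst n lam d R * ‖x - x₀‖ ^ (α / (α + 2)) *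
      (holderNormOn α (frontier Ω) φ + lpNormOn n Ω g) := by
  have hvΩ : ContinuousOn v Ω := hv.mono subset_closure
  obtain ⟨e, he, hinner⟩ := hΩ.exists_inner_ge hx₀
  have hR : 0 ≤ R := he ▸ norm_nonneg e
  have hdist : ∀ y ∈ Ω, ∀ x ∈ Ω, dist x y ≤ d := fun y hy x hx =>
    (dist_le_diam_of_mem hΩ.isBounded hx hy).trans hd
  have hd0 : 0 ≤ d := by simpa using hdist x hx x hx
  set c := abpConst n lam with hc
  have hc0 : 0 ≤ c := abpConst_nonneg hlam
  set G := lpNormOn n Ω g with hG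
  have hG0 : 0 ≤ G := ENNReal.toReal_nonneg
  set S := sSup (absValues (frontier Ω) φ) with hS
  have hS0 : 0 ≤ S := sSup_absValues_nonneg _ _
  set H := sSup (holderQuotients α (frontier Ω) φ) with hH
  have hH0 : 0 ≤ H := sSup_holderQuotients_nonneg _ _ _
  have hφS : ∀ y ∈ frontier Ω, |φ y| ≤ S := fun y hy => abs_le_sSup_absValues hφ hy
  have hglob : ∀ y ∈ Ω, v y ≤ S + d * (c * G) := by
    intro y hy
    have h1 := h.sub_inner_le hn hlam ha hg heq hΩ.isOpen hvΩ hΩ.isOpen hΩ.isBounded subset_rfl hv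
      (p := 0) (m := S) hy (fun z hz => ?_) (hdist y hy)
    · simpa using h1
    · rw [inner_zero_left, sub_zero, hvφ z hz]
      exact (le_abs_self _).trans (hφS z hz)
  set M₀ := 2 * S + d * (c * G) with hM₀
  have hM₀0 : 0 ≤ M₀ := by positivity
  have hglob0 : ∀ y ∈ Ω, v y ≤ φ x₀ + M₀ := fun y hy => by
    have h1 := hglob y hy
    have h2 := (abs_le.1 (hφS x₀ hx₀)).1
    linarith
  have hxne : x ≠ x₀ := by
    rintro rfl
    rw [hΩ.isOpen.frontier_eq] at hx₀
    exact hx₀.2 hx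
  set s := ‖x - x₀‖ with hs
  have hs0 : 0 < s := norm_pos_iff.2 (sub_ne_zero.2 hxne)
  set r := s ^ (1 / (α + 2)) with hr
  have hr0 : 0 < r := Real.rpow_pos_of_pos hs0 _
  have hr1 : r ≤ 1 := Real.rpow_le_one hs0.le hxx₀.le (by positivity)
  have hsr : s < r := by
    have h1 : s ^ (1 : ℝ) < s ^ (1 / (α + 2)) :=
      Real.rpow_lt_rpow_of_exponent_gt hs0 hxx₀ (by rw [div_lt_one] <;> linarith)
    rwa [Real.rpow_one] at h1
  have hrα : r ^ α = s ^ (α / (α + 2)) := by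
    rw [hr, ← Real.rpow_mul hs0.le]
    congr 1
    ring
  have hrs : s / r ^ 2 = s ^ (α / (α + 2)) := by
    rw [hr, ← Real.rpow_natCast, ← Real.rpow_mul hs0.le]
    nth_rewrite 1 [← Real.rpow_one s]
    rw [← Real.rpow_sub hs0]
    congr 1
    push_cast
    field_simp
    ring
  have hrle : r ≤ r ^ α := by
    nth_rewrite 1 [← Real.rpow_one r]
    exact Real.rpow_le_rpow_of_exponent_ge hr0 hr1 hα1.le
  -- The slope for which the barrier exceeds `M₀` on `Ω ∩ ∂B_r(x₀)`.
  set K := 2 * M₀ / r ^ 2 with hK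
  have hK0 : 0 ≤ K := by positivity
  have hloc := h.sub_inner_le hn hlam ha hg heq hΩ.isOpen hvΩ (U := Ω ∩ ball x₀ r)
    (hΩ.isOpen.inter isOpen_ball) (hΩ.isBounded.subset inter_subset_left) inter_subset_left
    (hv.mono (closure_mono inter_subset_left)) (p := K • e) (y := x)
    (m := φ x₀ + H * r ^ α - ⟪K • e, x₀⟫) (D := 2 * r)
    ⟨hx, by rw [mem_ball, dist_eq_norm]; exact hsr⟩ ?_ ?_
  · have h1 : ⟪K • e, x⟫ - ⟪K • e, x₀⟫ = K * ⟪e, x - x₀⟫ := by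
      rw [← inner_sub_right, real_inner_smul_left]
    have h2 : ⟪e, x - x₀⟫ ≤ R * s := by
      rw [← he]
      exact real_inner_le_norm _ _
    have h3 : K * ⟪e, x - x₀⟫ ≤ 2 * M₀ * R * s ^ (α / (α + 2)) := by
      calc K * ⟪e, x - x₀⟫ ≤ K * (R * s) := by gcongr
        _ = 2 * M₀ * R * (s / r ^ 2) := by rw [hK]; ring
        _ = _ := by rw [hrs]
    have h4 : 2 * r * (c * G) ≤ 2 * c * G * s ^ (α / (α + 2)) := by
      calc 2 * r * (c * G) = 2 * c * G * r := by ring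
        _ ≤ 2 * c * G * r ^ α := by gcongr
        _ = _ := by rw [hrα]
    have h5 : v x - v x₀ ≤ (H + 2 * M₀ * R + 2 * c * G) * s ^ (α / (α + 2)) := by
      rw [hvφ x₀ hx₀]
      rw [hrα] at hloc
      linarith
    refine h5.trans ?_
    rw [mul_right_comm (boundaryHolderConst n lam d R)]
    refine mul_le_mul_of_nonneg_right ?_ (Real.rpow_nonneg hs0.le _)
    rw [boundaryHolderConst, holderNormOn, ← hS, ← hH, ← hc, abs_of_nonneg hR, abs_of_nonneg hd0]
    have e1 : 0 ≤ R * H := by positivity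
    have e2 : 0 ≤ R * G := by positivity
    have e3 : 0 ≤ c * S := by positivity
    have e4 : 0 ≤ c * H := by positivity
    have e5 : 0 ≤ R * d * c * S := by positivity
    have e6 : 0 ≤ R * d * c * H := by positivity
    rw [hM₀]
    linarith
  · intro y hy
    rw [(hΩ.isOpen.inter isOpen_ball).frontier_eq] at hy
    have hyΩ : y ∈ closure Ω := closure_mono inter_subset_left hy.1
    have hyb : ‖y - x₀‖ ≤ r := by
      rw [← dist_eq_norm]
      exact closure_ball_subset_closedBall (closure_mono inter_subset_right hy.1)
    have h1 : ⟪K • e, y⟫ - ⟪K • e, x₀⟫ = K * ⟪e, y - x₀⟫ := by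
      rw [← inner_sub_right, real_inner_smul_left]
    have h2 := hinner y hyΩ
    by_cases hyin : y ∈ Ω
    · have h3 : r ≤ ‖y - x₀‖ := by
        by_contra! hlt
        exact hy.2 ⟨hyin, by rwa [mem_ball, dist_eq_norm]⟩
      have h4 : M₀ ≤ K * ⟪e, y - x₀⟫ := by
        calc M₀ = K * (r ^ 2 / 2) := by rw [hK]; field_simp
          _ ≤ K * ⟪e, y - x₀⟫ := by
              gcongr
              refine le_trans ?_ h2
              gcongr
      have h5 := hglob0 y hyin
      have h6 : 0 ≤ H * r ^ α := by positivity
      linarith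
    · have hyf : y ∈ frontier Ω := by
        rw [hΩ.isOpen.frontier_eq]
        exact ⟨hyΩ, hyin⟩
      have h3 := (le_abs_self _).trans (abs_sub_le_sSup_holderQuotients_mul hφ hyf hx₀)
      have h4 : H * ‖y - x₀‖ ^ α ≤ H * r ^ α := by gcongr
      have h5 : 0 ≤ K * ⟪e, y - x₀⟫ := mul_nonneg hK0 (le_trans (by positivity) h2)
      rw [hvφ y hyf]
      linarith
  · intro y hy
    have h1 := mem_ball.1 hy.2
    have h2 : dist x x₀ < r := by rw [dist_eq_norm]; exact hsr
    have h3 := dist_triangle_right y x x₀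
    linarith

/-! ### Changing the sign of the solution -/

theorem HasWeakPartialDeriv.neg {Ω : Set (EuclideanSpace ℝ (Fin n))} {i : Fin n}
    {u w : EuclideanSpace ℝ (Fin n) → ℝ} (h : HasWeakPartialDeriv Ω i u w) :
    HasWeakPartialDeriv Ω i (-u) (-w) where
  locallyIntegrableOn := h.locallyIntegrableOn.neg
  locallyIntegrableOn_deriv := h.locallyIntegrableOn_deriv.neg
  integral_eq η h1 h2 h3 := by
    have h4 := h.integral_eq η h1 h2 h3
    simp only [Pi.neg_apply, neg_mul, integral_neg, h4]

theorem MemSobolevTwoLoc.neg {p : ℝ≥0∞} {Ω : Set (EuclideanSpace ℝ (Fin n))}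
    {v : EuclideanSpace ℝ (Fin n) → ℝ} {Dv : Fin n → EuclideanSpace ℝ (Fin n) → ℝ}
    {D2v : Fin n → Fin n → EuclideanSpace ℝ (Fin n) → ℝ} (h : MemSobolevTwoLoc p Ω v Dv D2v) :
    MemSobolevTwoLoc p Ω (-v) (fun i => -Dv i) (fun i j => -D2v i j) where
  memLpLoc K hK hKΩ := (h.memLpLoc K hK hKΩ).neg
  memLpLoc_deriv i K hK hKΩ := (h.memLpLoc_deriv i K hK hKΩ).neg
  memLpLoc_deriv2 i j K hK hKΩ := (h.memLpLoc_deriv2 i j K hK hKΩ).neg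
  weak_deriv i := (h.weak_deriv i).neg
  weak_deriv2 i j := (h.weak_deriv2 i j).neg

theorem absValues_neg (S : Set (EuclideanSpace ℝ (Fin n))) (φ : EuclideanSpace ℝ (Fin n) → ℝ) :
    absValues S (-φ) = absValues S φ := by
  simp [absValues]

theorem holderQuotients_neg (α : ℝ) (S : Set (EuclideanSpace ℝ (Fin n)))
    (φ : EuclideanSpace ℝ (Fin n) → ℝ) : holderQuotients α S (-φ) = holderQuotients α S φ := by
  have h : ∀ x y, |(-φ) x - (-φ) y| = |φ x - φ y| := fun x y => by
    rw [← abs_neg, Pi.neg_apply, Pi.neg_apply]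
    congr 1
    ring
  simp only [holderQuotients, h]

theorem proposition2p4 (n : ℕ) (hn : 1 ≤ n) (lam α d R : ℝ) (hlam : 0 < lam)
    (hα : 0 < α) (hα1 : α < 1) :
    ∃ δ C : ℝ, 0 < δ ∧ 0 < C ∧
      ∀ Ω : Set (EuclideanSpace ℝ (Fin n)),
        IsUniformlyConvexDomain R Ω → Metric.diam Ω ≤ d →
      ∀ (a : EuclideanSpace ℝ (Fin n) → Matrix (Fin n) (Fin n) ℝ)
        (g φ v : EuclideanSpace ℝ (Fin n) → ℝ)
        (Dv : Fin n → EuclideanSpace ℝ (Fin n) → ℝ)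
        (D2v : Fin n → Fin n → EuclideanSpace ℝ (Fin n) → ℝ),
        (∀ i j, AEMeasurable (fun x => a x i j) (volume.restrict Ω)) →
        (∀ᵐ x ∂(volume.restrict Ω), (a x).PosDef ∧ lam ≤ (a x).det) →
        MemLp g (n : ℝ≥0∞) (volume.restrict Ω) →
        MemHolderOn α (frontier Ω) φ →
        ContinuousOn v (closure Ω) →
        MemSobolevTwoLoc (n : ℝ≥0∞) Ω v Dv D2v →
        (∀ᵐ x ∂(volume.restrict Ω), ∑ i, ∑ j, a x i j * D2v i j x = g x) →
        (∀ x ∈ frontier Ω, v x = φ x) →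
        ∀ x₀ ∈ frontier Ω, ∀ x ∈ Ω ∩ Metric.ball x₀ δ,
          |v x - v x₀| ≤ C * ‖x - x₀‖ ^ (α / (α + 2)) *
            (holderNormOn α (frontier Ω) φ + lpNormOn (n : ℝ≥0∞) Ω g) := by
  refine ⟨1, boundaryHolderConst n lam d R, one_pos, boundaryHolderConst_pos hlam d R, ?_⟩
  intro Ω hΩ hd a g φ v Dv D2v _ ha hg hφ hv h heq hvφ x₀ hx₀ x hx
  have hxx₀ : ‖x - x₀‖ < 1 := by
    rw [← dist_eq_norm]
    exact hx.2
  have hup := h.sub_le_rpow hn hlam hα hα1 hΩ hd ha hg hφ hv heq hvφ hx₀ hx.1 hxx₀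
  have hφ' : MemHolderOn α (frontier Ω) (-φ) := by
    rwa [MemHolderOn, absValues_neg, holderQuotients_neg]
  have heq' : ∀ᵐ x ∂(volume.restrict Ω), ∑ i, ∑ j, a x i j * (-D2v i j) x = (-g) x := by
    filter_upwards [heq] with y hy
    simp only [Pi.neg_apply, mul_neg, Finset.sum_neg_distrib, hy]
  have hlow := h.neg.sub_le_rpow hn hlam hα hα1 hΩ hd ha hg.neg hφ' hv.neg heq'
    (fun y hy => by rw [Pi.neg_apply, Pi.neg_apply, hvφ y hy]) hx₀ hx.1 hxx₀
  rw [holderNormOn, absValues_neg, holderQuotients_neg, lpNormOn, eLpNorm_neg, Pi.neg_apply,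
    Pi.neg_apply] at hlow
  rw [abs_le]
  constructor
  · rw [holderNormOn, lpNormOn]
    linarith
  · exact hup
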